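/- **Setting.** Fix finite join-semilattices with bottom $(\mathsf B_i)_{i}$, finite sets $(A_k)_k$ (constants $b\in\mathsf B_i$ and actions $a\in A_k$ carry their index, i.e. the families are regarded as disjoint), and an infinite set $X$ of variables. *Non-deterministic functors* on sets are given by $$G ::= \mathrm{Id}\mid \mathsf B_i\mid G\diamond G\mid G\times G\mid G^{A_k}\mid \mathcal P_\omega G ,$$ where $\mathcal P_\omega$ is finite powerset and $S\diamond T = S\uplus T\uplus\{\bot,\top\}$ (with injections $\kappa_1,\kappa_2$; on maps, $\bot,\top$ are fixed). $F\lhd G$ is the least reflexive transitive relation with $F_j\lhd F_1\times F_2$, $F_j\lhd F_1\diamond F_2$, $F\lhd F^{A_k}$, $F\lhd\mathcal P_\omega F$. *Expressions* and *guarded expressions* are $$\varepsilon ::= \emptyset\mid x\mid \varepsilon\oplus\varepsilon\mid\mu x.\gamma\mid b\mid l\langle\varepsilon\rangle\mid r\langle\varepsilon\rangle\mid l[\varepsilon]\mid r[\varepsilon]\mid a(\varepsilon)\mid\{\varepsilon\},$$ $$\gamma ::= \emptyset\mid \gamma\oplus\gamma\mid\mu x.\gamma\mid b\mid l\langle\varepsilon\rangle\mid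 r\langle\varepsilon\rangle\mid l[\varepsilon]\mid r[\varepsilon]\mid a(\varepsilon)\mid\{\varepsilon\}.$$ The typing judgements $\vdash\varepsilon:F\lhd G$ (always with $F\lhd G$) are generated by: $\emptyset:F\lhd G$; $b:\mathsf B_i\lhd G$ for $b\in\mathsf B_i$; $x:G\lhd G$; if $\varepsilon:G\lhd G$ then $\mu x.\varepsilon:G\lhd G$ and $\varepsilon:\mathrm{Id}\lhd G$; if $\varepsilon_1,\varepsilon_2:F\lhd G$ then $\varepsilon_1\oplus\varepsilon_2:F\lhd G$; if $\varepsilon:F\lhd G$ then $\{\varepsilon\}:\mathcal P_\omega F\lhd G$ and $a(\varepsilon):F^{A_k}\lhd G$ for $a\in A_k$; if $\varepsilon:F_1\lhd G$ then $l\langle\varepsilon\rangle:F_1\times F_2\lhd G$ and $l[\varepsilon]:F_1\diamond F_2\lhd G$; if $\varepsilon:F_2\lhd G$ then $r\langle\varepsilon\rangle:F_1\times F_2\lhd G$ and $r[\varepsilon]:F_1\diamond F_2\lhd G$. Let $\mathrm{Exp}_{F\lhd G}$ be the set of closed expressions $\varepsilon$ with $\vdash\varepsilon:F\lhd G$, and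 $\mathrm{Exp}_G=\mathrm{Exp}_{G\lhd G}$. Substitution $\varepsilon[\varepsilon'/x]$ is capture-avoiding. *Coalgebra structure.* Let $\mathrm{Empty}_F\in F(\mathrm{Exp}_G)$ be $\emptyset$ for $F=\mathrm{Id}$, $\bot_{\mathsf B_i}$ for $\mathsf B_i$, $\bot$ for $F_1\diamond F_2$, the empty set for $\mathcal P_\omega F$, and componentwise for products and powers. Let $\mathrm{Plus}_F$ be the operation on $F(\mathrm{Exp}_G)$ that is $\oplus$ for $\mathrm{Id}$, $\vee$ for $\mathsf B_i$, union for $\mathcal P_\omega F$, componentwise for products and powers, and for $F_1\diamond F_2$ has $\bot$ neutral, $\top$ absorbing, $\mathrm{Plus}(\kappa_j(u),\kappa_j(v))=\kappa_j(\mathrm{Plus}_{F_j}(u,v))$ and $\mathrm{Plus}(\kappa_i(u),\kappa_j(v))=\top$ for $i\ne j$. Then $\delta_F:\mathrm{Exp}_{F\lhd G}\to F(\mathrm{Exp}_G)$ is determined by $\delta_F(\emptyset)=\mathrm{Empty}_F$; $\delta_F(\varepsilon_1\oplus\varepsilon_2)=\mathrm{Plus}_F(\delta_F(\varepsilon_1),\delta_F(\varepsilon_2))$;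 $\delta_G(\mu x.\gamma)=\delta_G(\gamma[\mu x.\gamma/x])$; $\delta_{\mathrm{Id}}(\varepsilon)=\varepsilon$ if $G\neq\mathrm{Id}$; $\delta_{\mathsf B_i}(b)=b$; $\delta_{F_1\times F_2}(l\langle\varepsilon\rangle)=(\delta_{F_1}(\varepsilon),\mathrm{Empty}_{F_2})$; $\delta_{F_1\times F_2}(r\langle\varepsilon\rangle)=(\mathrm{Empty}_{F_1},\delta_{F_2}(\varepsilon))$; $\delta_{F_1\diamond F_2}(l[\varepsilon])=\kappa_1(\delta_{F_1}(\varepsilon))$; $\delta_{F_1\diamond F_2}(r[\varepsilon])=\kappa_2(\delta_{F_2}(\varepsilon))$; $\delta_{F^{A_k}}(a(\varepsilon))$ sends $a$ to $\delta_F(\varepsilon)$ and every $a'\ne a$ to $\mathrm{Empty}_F$; $\delta_{\mathcal P_\omega F}(\{\varepsilon\})=\{\delta_F(\varepsilon)\}$. *Bisimilarity.* Elements $\varepsilon_1,\varepsilon_2\in\mathrm{Exp}_G$ are bisimilar, $\varepsilon_1\sim\varepsilon_2$, if $(\varepsilon_1,\varepsilon_2)\in R$ for some $R\subseteq\mathrm{Exp}_G\times\mathrm{Exp}_G$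 such that for all $(s,t)\in R$ there is $u\in G(R)$ with $G(\pi_1)(u)=\delta_G(s)$ and $G(\pi_2)(u)=\delta_G(t)$. *Axiomatization.* The relations $\equiv$ on the sets $\mathrm{Exp}_{F\lhd G}$ ($F\lhd G$) are jointly the least equivalence relations that contain the following identities whenever both sides lie in $\mathrm{Exp}_{F\lhd G}$: 1. $\varepsilon\oplus\varepsilon\equiv\varepsilon$, $\ \varepsilon_1\oplus\varepsilon_2\equiv\varepsilon_2\oplus\varepsilon_1$, $\ \varepsilon_1\oplus(\varepsilon_2\oplus\varepsilon_3)\equiv(\varepsilon_1\oplus\varepsilon_2)\oplus\varepsilon_3$, $\ \emptyset\oplus\varepsilon\equiv\varepsilon$; 2. (FP) $\gamma[\mu x.\gamma/x]\equiv\mu x.\gamma$; 3. $\emptyset\equiv\bot_{\mathsf B_i}$, $\ b_1\oplus b_2\equiv b_1\vee b_2$ for $b_1,b_2\in\mathsf B_i$; $\ l\langle\emptyset\rangle\equiv\emptyset$, $\ r\langle\emptyset\rangle\equiv\emptyset$, $\ a(\emptyset)\equiv\emptyset$; $\ l\langle\varepsilon_1\oplus\varepsilon_2\rangle\equiv l\langle\varepsilon_1\rangle\oplus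 l\langle\varepsilon_2\rangle$ and likewise for $r\langle-\rangle$, $a(-)$, $l[-]$ and $r[-]$; $\ l[\varepsilon_1]\oplus r[\varepsilon_2]\equiv l[\emptyset]\oplus r[\emptyset]$; 4. ($\alpha$) $\mu x.\gamma\equiv\mu y.\gamma[y/x]$ for $y$ not free in $\gamma$; and that are closed under the rules 5. (Unique) if $\gamma[\varepsilon/x]\equiv\varepsilon$ then $\mu x.\gamma\equiv\varepsilon$; 6. (Cong) if $\varepsilon_1\equiv\varepsilon_2$ (in any $\mathrm{Exp}_{F'\lhd G}$), $x$ is free in the expression $\varepsilon$, and $\varepsilon[\varepsilon_1/x],\varepsilon[\varepsilon_2/x]\in\mathrm{Exp}_{F\lhd G}$, then $\varepsilon[\varepsilon_1/x]\equiv\varepsilon[\varepsilon_2/x]$. **Theorem (Completeness).** Let $G$ be a non-deterministic functor. For all $\varepsilon_1,\varepsilon_2\in\mathrm{Exp}_G$, $$\varepsilon_1\sim\varepsilon_2\ \Longrightarrow\ \varepsilon_1\equiv\varepsilon_2 .$$ -/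

import Mathlib

universe u

namespace NDCoalg

/-- The set `α ⊎ β ⊎ {⊥, ⊤}`. -/
inductive DPlus (α β : Type u) : Type u
  | bot : DPlus α β
  | top : DPlus α β
  | inl : α → DPlus α β
  | inr : β → DPlus α β

/-- Action of the modified sum on functions; it fixes `⊥` and `⊤`. -/
def DPlus.map {α β α' β' : Type u} (f : α → α') (g : β → β') : DPlus α β → DPlus α' β'
  | .bot => .bot
  | .top => .top
  | .inl a => .inl (f a)
  | .inr b => .inr (g b)

/-- Combines two elements of the modified sum: `⊥` is neutral, `⊤` is absorbing, and elements of
different summands are inconsistent. -/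
def DPlus.join {α β : Type u} (p : α → α → α) (q : β → β → β) :
    DPlus α β → DPlus α β → DPlus α β
  | .bot, y => y
  | x, .bot => x
  | .top, _ => .top
  | _, .top => .top
  | .inl a, .inl a' => .inl (p a a')
  | .inr b, .inr b' => .inr (q b b')
  | .inl _, .inr _ => .top
  | .inr _, .inl _ => .top

/-- Non-deterministic functors, built from the identity and the constants `B i` with products,
modified sums, powers with exponents `A k`, and finite powersets. -/
inductive NDF {ι κ : Type u} (B : ι → Type u) (A : κ → Type u) : Type u
  | id : NDF B A
  | const (i : ι) : NDF B A
  | sum (F₁ F₂ : NDF B A) : NDF B A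
  | prod (F₁ F₂ : NDF B A) : NDF B A
  | pow (F : NDF B A) (k : κ) : NDF B A
  | pset (F : NDF B A) : NDF B A

section Functors

variable {ι κ : Type u} {B : ι → Type u} {A : κ → Type u}

/-- The action of a non-deterministic functor on sets. -/
@[reducible]
def NDF.obj : NDF B A → Type u → Type u
  | .id, Y => Y
  | .const i, _ => B i
  | .sum F₁ F₂, Y => DPlus (F₁.obj Y) (F₂.obj Y)
  | .prod F₁ F₂, Y => F₁.obj Y × F₂.obj Y
  | .pow F k, Y => A k → F.obj Y
  | .pset F, Y => {s : Set (F.obj Y) // s.Finite}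

/-- The action of a non-deterministic functor on functions. -/
def NDF.map {Y Z : Type u} (f : Y → Z) : (F : NDF B A) → F.obj Y → F.obj Z
  | .id => f
  | .const _ => fun b => b
  | .sum F₁ F₂ => DPlus.map (F₁.map f) (F₂.map f)
  | .prod F₁ F₂ => fun c => (F₁.map f c.1, F₂.map f c.2)
  | .pow F _ => fun c a => F.map f (c a)
  | .pset F => fun s => ⟨F.map f '' s.1, s.2.image _⟩

/-- The immediate ingredients of a functor. -/
inductive NDF.Step : NDF B A → NDF B A → Prop
  | sum_left (F₁ F₂ : NDF B A) : NDF.Step F₁ (.sum F₁ F₂)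
  | sum_right (F₁ F₂ : NDF B A) : NDF.Step F₂ (.sum F₁ F₂)
  | prod_left (F₁ F₂ : NDF B A) : NDF.Step F₁ (.prod F₁ F₂)
  | prod_right (F₁ F₂ : NDF B A) : NDF.Step F₂ (.prod F₁ F₂)
  | pow (F : NDF B A) (k : κ) : NDF.Step F (.pow F k)
  | pset (F : NDF B A) : NDF.Step F (.pset F)

/-- `F.Ingredient G` is `F ◁ G`: the least reflexive transitive relation containing `Step`. -/
def NDF.Ingredient : NDF B A → NDF B A → Prop :=
  Relation.ReflTransGen NDF.Step

/-- A relation `R` is a bisimulation between the coalgebras `(S, f)` and `(T, g)` if related states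
have successors of the form `G(π₁)(x)` and `G(π₂)(x)` for some `x ∈ G(R)`. -/
def IsBisimulation (G : NDF B A) {S T : Type u} (f : S → G.obj S) (g : T → G.obj T)
    (R : Set (S × T)) : Prop :=
  ∀ s t, (s, t) ∈ R → ∃ x : G.obj R,
    G.map (fun p : R => p.1.1) x = f s ∧ G.map (fun p : R => p.1.2) x = g t

/-- Bisimilarity of states of two coalgebras. -/
def Bisimilar (G : NDF B A) {S T : Type u} (f : S → G.obj S) (g : T → G.obj T)
    (s : S) (t : T) : Prop :=
  ∃ R : Set (S × T), IsBisimulation G f g R ∧ (s, t) ∈ R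

/-- The element of `F(Y)` induced by an element `z` of `Y` (which stands for the empty
expression). -/
def NDF.empty [∀ i, SemilatticeSup (B i)] [∀ i, OrderBot (B i)] {Y : Type u} (z : Y) :
    (F : NDF B A) → F.obj Y
  | .id => z
  | .const i => (⊥ : B i)
  | .sum _ _ => .bot
  | .prod F₁ F₂ => (F₁.empty z, F₂.empty z)
  | .pow F _ => fun _ => F.empty z
  | .pset _ => ⟨∅, Set.finite_empty⟩

/-- The binary operation on `F(Y)` induced by a binary operation `p` on `Y` (which stands for the
sum of expressions). -/
def NDF.plus [∀ i, SemilatticeSup (B i)] {Y : Type u} (p : Y → Y → Y) :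
    (F : NDF B A) → F.obj Y → F.obj Y → F.obj Y
  | .id => p
  | .const i => fun b₁ b₂ => ((b₁ : B i) ⊔ (b₂ : B i) : B i)
  | .sum F₁ F₂ => DPlus.join (F₁.plus p) (F₂.plus p)
  | .prod F₁ F₂ => fun c d => (F₁.plus p c.1 d.1, F₂.plus p c.2 d.2)
  | .pow F _ => fun c d a => F.plus p (c a) (d a)
  | .pset _ => fun s t => ⟨s.1 ∪ t.1, s.2.union t.2⟩

end Functors

/-- Untyped terms: empty, variables, sum, fixed points, constants `b`, `l⟨e⟩`, `r⟨e⟩`, `l[e]`,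
`r[e]`, `a(e)` and `{e}`. Constants and actions remember the set they are taken from. -/
inductive Term {ι κ : Type u} (B : ι → Type u) (A : κ → Type u) (X : Type u) : Type u
  | emp : Term B A X
  | var (x : X) : Term B A X
  | plus (e₁ e₂ : Term B A X) : Term B A X
  | mu (x : X) (e : Term B A X) : Term B A X
  | const (i : ι) (b : B i) : Term B A X
  | fst (e : Term B A X) : Term B A X
  | snd (e : Term B A X) : Term B A X
  | inl (e : Term B A X) : Term B A X
  | inr (e : Term B A X) : Term B A X
  | act (k : κ) (a : A k) (e : Term B A X) : Term B A X
  | single (e : Term B A X) : Term B A X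

section Expressions

variable {ι κ : Type u} {B : ι → Type u} {A : κ → Type u} {X : Type u}

/-- No variable occurs outside the scope of `l⟨-⟩`, `r⟨-⟩`, `l[-]`, `r[-]`, `a(-)`, `{-}`. -/
def Term.IsGuarded : Term B A X → Prop
  | .var _ => False
  | .plus e₁ e₂ => e₁.IsGuarded ∧ e₂.IsGuarded
  | .mu _ e => e.IsGuarded
  | _ => True

/-- The expressions among the terms: the body of every fixed point is guarded. -/
def Term.IsExpr : Term B A X → Prop
  | .emp => True
  | .var _ => True
  | .const _ _ => True
  | .plus e₁ e₂ => e₁.IsExpr ∧ e₂.IsExpr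
  | .mu _ e => e.IsGuarded ∧ e.IsExpr
  | .fst e => e.IsExpr
  | .snd e => e.IsExpr
  | .inl e => e.IsExpr
  | .inr e => e.IsExpr
  | .act _ _ e => e.IsExpr
  | .single e => e.IsExpr

/-- `Typed G e F` is the typing judgement `⊢ e : F ◁ G`. -/
inductive Typed (G : NDF B A) : Term B A X → NDF B A → Prop
  | emp {F : NDF B A} (hF : F.Ingredient G) : Typed G .emp F
  | const (i : ι) (b : B i) (hF : (NDF.const i).Ingredient G) : Typed G (.const i b) (.const i)
  | var (x : X) : Typed G (.var x) G
  | mu (x : X) {e : Term B A X} : Typed G e G → Typed G (.mu x e) G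
  | plus {e₁ e₂ : Term B A X} {F : NDF B A} :
      Typed G e₁ F → Typed G e₂ F → Typed G (.plus e₁ e₂) F
  | ident {e : Term B A X} (hF : NDF.id.Ingredient G) : Typed G e G → Typed G e .id
  | single {e : Term B A X} {F : NDF B A} (hF : F.pset.Ingredient G) :
      Typed G e F → Typed G (.single e) (.pset F)
  | act {k : κ} (a : A k) {e : Term B A X} {F : NDF B A} (hF : (F.pow k).Ingredient G) :
      Typed G e F → Typed G (.act k a e) (.pow F k)
  | fst {e : Term B A X} {F₁ F₂ : NDF B A} (hF : (F₁.prod F₂).Ingredient G) :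
      Typed G e F₁ → Typed G (.fst e) (.prod F₁ F₂)
  | snd {e : Term B A X} {F₁ F₂ : NDF B A} (hF : (F₁.prod F₂).Ingredient G) :
      Typed G e F₂ → Typed G (.snd e) (.prod F₁ F₂)
  | inl {e : Term B A X} {F₁ F₂ : NDF B A} (hF : (F₁.sum F₂).Ingredient G) :
      Typed G e F₁ → Typed G (.inl e) (.sum F₁ F₂)
  | inr {e : Term B A X} {F₁ F₂ : NDF B A} (hF : (F₁.sum F₂).Ingredient G) :
      Typed G e F₂ → Typed G (.inr e) (.sum F₁ F₂)

theorem Typed.ingredient {G F : NDF B A} {e : Term B A X} (h : Typed G e F) : F.Ingredient G := by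
  induction h with
  | var | mu => exact Relation.ReflTransGen.refl
  | plus _ _ ih _ => exact ih
  | _ => assumption

theorem Typed.of_plus {G F : NDF B A} {e₁ e₂ : Term B A X} (h : Typed G (.plus e₁ e₂) F) :
    Typed G e₁ F ∧ Typed G e₂ F := by
  generalize he : Term.plus e₁ e₂ = e at h
  induction h with
  | plus h₁ h₂ => cases he; exact ⟨h₁, h₂⟩
  | ident hF _ ih => exact ⟨.ident hF (ih he).1, .ident hF (ih he).2⟩
  | _ => cases he

theorem Typed.of_mu {G F : NDF B A} {x : X} {e : Term B A X} (h : Typed G (.mu x e) F) :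
    Typed G e G ∧ (F = G ∨ F = .id) := by
  generalize he : Term.mu x e = d at h
  induction h with
  | mu x h => cases he; exact ⟨h, .inl rfl⟩
  | ident hF _ ih => exact ⟨(ih he).1, .inr rfl⟩
  | _ => cases he

theorem Typed.of_ident {G F : NDF B A} {e : Term B A X} (h : Typed G e F) (hF : F = .id) :
    Typed G e G := by
  induction h with
  | emp => exact .emp Relation.ReflTransGen.refl
  | var x => exact .var x
  | mu x h => exact .mu x h
  | plus _ _ ih₁ ih₂ => exact .plus (ih₁ hF) (ih₂ hF)
  | ident _ h => exact h
  | _ => cases hF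

theorem Typed.of_const {G : NDF B A} {i j : ι} {b : B j}
    (h : Typed G (.const j b : Term B A X) (.const i)) : j = i := by
  cases h; rfl

/-- The nesting depth of unguarded sums and fixed points. -/
def Term.depth : Term B A X → ℕ
  | .plus e₁ e₂ => 1 + max e₁.depth e₂.depth
  | .mu _ e => 1 + e.depth
  | _ => 0

variable [DecidableEq X]

/-- Free variables. -/
def Term.fv : Term B A X → Finset X
  | .emp => ∅
  | .var x => {x}
  | .plus e₁ e₂ => e₁.fv ∪ e₂.fv
  | .mu x e => e.fv.erase x
  | .const _ _ => ∅
  | .fst e => e.fv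
  | .snd e => e.fv
  | .inl e => e.fv
  | .inr e => e.fv
  | .act _ _ e => e.fv
  | .single e => e.fv

/-- The set of closed expressions `e` with `⊢ e : F ◁ G`. -/
def IsExp (G F : NDF B A) (e : Term B A X) : Prop :=
  e.fv = ∅ ∧ e.IsExpr ∧ Typed G e F

/-- The set `Exp_{F ◁ G}`, as a type. The set of `G`-expressions is `Exp X G G`. -/
abbrev Exp (X : Type u) [DecidableEq X] (G F : NDF B A) : Type u :=
  {e : Term B A X // IsExp G F e}

theorem IsExp.of_ident {G : NDF B A} {e : Term B A X} (h : IsExp G .id e) : IsExp G G e :=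
  ⟨h.1, h.2.1, h.2.2.of_ident rfl⟩

theorem IsExp.of_plus_left {G F : NDF B A} {e₁ e₂ : Term B A X} (h : IsExp G F (.plus e₁ e₂)) :
    IsExp G F e₁ :=
  ⟨(Finset.union_eq_empty.mp h.1).1, h.2.1.1, h.2.2.of_plus.1⟩

theorem IsExp.of_plus_right {G F : NDF B A} {e₁ e₂ : Term B A X} (h : IsExp G F (.plus e₁ e₂)) :
    IsExp G F e₂ :=
  ⟨(Finset.union_eq_empty.mp h.1).2, h.2.1.2, h.2.2.of_plus.2⟩

theorem IsExp.of_fst {G F₁ F₂ : NDF B A} {e : Term B A X} (h : IsExp G (.prod F₁ F₂) (.fst e)) :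
    IsExp G F₁ e :=
  ⟨h.1, h.2.1, by cases h.2.2; assumption⟩

theorem IsExp.of_snd {G F₁ F₂ : NDF B A} {e : Term B A X} (h : IsExp G (.prod F₁ F₂) (.snd e)) :
    IsExp G F₂ e :=
  ⟨h.1, h.2.1, by cases h.2.2; assumption⟩

theorem IsExp.of_inl {G F₁ F₂ : NDF B A} {e : Term B A X} (h : IsExp G (.sum F₁ F₂) (.inl e)) :
    IsExp G F₁ e :=
  ⟨h.1, h.2.1, by cases h.2.2; assumption⟩

theorem IsExp.of_inr {G F₁ F₂ : NDF B A} {e : Term B A X} (h : IsExp G (.sum F₁ F₂) (.inr e)) :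
    IsExp G F₂ e :=
  ⟨h.1, h.2.1, by cases h.2.2; assumption⟩

theorem IsExp.of_act {G F : NDF B A} {k k' : κ} {a : A k'} {e : Term B A X}
    (h : IsExp G (.pow F k) (.act k' a e)) : IsExp G F e :=
  ⟨h.1, h.2.1, by cases h.2.2; assumption⟩

theorem IsExp.of_single {G F : NDF B A} {e : Term B A X} (h : IsExp G (.pset F) (.single e)) :
    IsExp G F e :=
  ⟨h.1, h.2.1, by cases h.2.2; assumption⟩

variable [Infinite X]

/-- A variable outside a given finite set. -/
noncomputable def fresh (s : Finset X) : X :=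
  (Infinite.exists_notMem_finset s).choose

/-- The name of a bound variable `y` after a substitution whose result has the variables `s` free
below the binder: `y` is kept unless it would capture one of them. -/
noncomputable def rename (y : X) (s : Finset X) : X :=
  if y ∈ s then fresh s else y

/-- Simultaneous capture-avoiding substitution. -/
noncomputable def Term.bind : Term B A X → (X → Term B A X) → Term B A X
  | .emp, _ => .emp
  | .var x, σ => σ x
  | .plus e₁ e₂, σ => .plus (e₁.bind σ) (e₂.bind σ)
  | .mu y e, σ =>
      .mu (rename y ((e.fv.erase y).biUnion fun w => (σ w).fv))
        (e.bind (Function.update σ y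
          (.var (rename y ((e.fv.erase y).biUnion fun w => (σ w).fv)))))
  | .const i b, _ => .const i b
  | .fst e, σ => .fst (e.bind σ)
  | .snd e, σ => .snd (e.bind σ)
  | .inl e, σ => .inl (e.bind σ)
  | .inr e, σ => .inr (e.bind σ)
  | .act k a e, σ => .act k a (e.bind σ)
  | .single e, σ => .single (e.bind σ)

/-- Capture-avoiding substitution `e[d/x]`. -/
noncomputable def Term.subst (e : Term B A X) (x : X) (d : Term B A X) : Term B A X :=
  e.bind (Function.update .var x d)

theorem Term.mem_fv_bind {v : X} (e : Term B A X) :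
    ∀ σ : X → Term B A X, v ∈ (e.bind σ).fv → ∃ w ∈ e.fv, v ∈ (σ w).fv := by
  induction e with
  | emp => intro σ h; simp [Term.bind, Term.fv] at h
  | const i b => intro σ h; simp [Term.bind, Term.fv] at h
  | var x => intro σ h; exact ⟨x, by simp [Term.fv], h⟩
  | plus e₁ e₂ ih₁ ih₂ =>
    intro σ h
    simp only [Term.bind, Term.fv, Finset.mem_union] at h
    rcases h with h | h
    · obtain ⟨w, hw, hv⟩ := ih₁ σ h
      exact ⟨w, by simp [Term.fv, hw], hv⟩
    · obtain ⟨w, hw, hv⟩ := ih₂ σ h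
      exact ⟨w, by simp [Term.fv, hw], hv⟩
  | mu y e ih =>
    intro σ h
    simp only [Term.bind, Term.fv, Finset.mem_erase] at h
    obtain ⟨w, hw, hv⟩ := ih _ h.2
    by_cases hwy : w = y
    · subst hwy
      rw [Function.update_self] at hv
      simp only [Term.fv, Finset.mem_singleton] at hv
      exact absurd hv h.1
    · rw [Function.update_of_ne hwy] at hv
      exact ⟨w, by simp [Term.fv, hw, hwy], hv⟩
  | fst e ih => intro σ h; exact ih σ h
  | snd e ih => intro σ h; exact ih σ h
  | inl e ih => intro σ h; exact ih σ h
  | inr e ih => intro σ h; exact ih σ h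
  | act k a e ih => intro σ h; exact ih σ h
  | single e ih => intro σ h; exact ih σ h

theorem Term.IsGuarded.bind {e : Term B A X} :
    e.IsGuarded → ∀ σ : X → Term B A X, (e.bind σ).IsGuarded := by
  induction e with
  | var x => intro h; exact h.elim
  | plus e₁ e₂ ih₁ ih₂ => intro h σ; exact ⟨ih₁ h.1 σ, ih₂ h.2 σ⟩
  | mu y e ih => intro h σ; exact ih h _
  | _ => intro _ _; trivial

theorem Term.IsExpr.bind {e : Term B A X} :
    e.IsExpr → ∀ σ : X → Term B A X, (∀ w, (σ w).IsExpr) → (e.bind σ).IsExpr := by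
  induction e with
  | emp => intro _ _ _; trivial
  | const i b => intro _ _ _; trivial
  | var x => intro _ σ hσ; exact hσ x
  | plus e₁ e₂ ih₁ ih₂ => intro h σ hσ; exact ⟨ih₁ h.1 σ hσ, ih₂ h.2 σ hσ⟩
  | mu y e ih =>
    intro h σ hσ
    refine ⟨h.1.bind _, ih h.2 _ fun w => ?_⟩
    by_cases hwy : w = y
    · subst hwy; rw [Function.update_self]; trivial
    · rw [Function.update_of_ne hwy]; exact hσ w
  | fst e ih => intro h σ hσ; exact ih h σ hσ
  | snd e ih => intro h σ hσ; exact ih h σ hσ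
  | inl e ih => intro h σ hσ; exact ih h σ hσ
  | inr e ih => intro h σ hσ; exact ih h σ hσ
  | act k a e ih => intro h σ hσ; exact ih h σ hσ
  | single e ih => intro h σ hσ; exact ih h σ hσ

theorem Term.IsGuarded.depth_bind {e : Term B A X} :
    e.IsGuarded → ∀ σ : X → Term B A X, (e.bind σ).depth = e.depth := by
  induction e with
  | var x => intro h; exact h.elim
  | plus e₁ e₂ ih₁ ih₂ =>
    intro h σ; simp only [Term.bind, Term.depth, ih₁ h.1 σ, ih₂ h.2 σ]
  | mu y e ih => intro h σ; simp only [Term.bind, Term.depth]; rw [ih h _]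
  | _ => intro _ _; rfl

theorem Typed.bind {G F : NDF B A} {e : Term B A X} (h : Typed G e F) :
    ∀ σ : X → Term B A X, (∀ w, Typed G (σ w) G) → Typed G (e.bind σ) F := by
  induction h with
  | emp hF => intro _ _; exact .emp hF
  | const i b hF => intro _ _; exact .const i b hF
  | var x => intro σ hσ; exact hσ x
  | mu y h ih =>
    intro σ hσ
    refine .mu _ (ih _ fun w => ?_)
    by_cases hwy : w = y
    · subst hwy; rw [Function.update_self]; exact .var _
    · rw [Function.update_of_ne hwy]; exact hσ w
  | plus _ _ ih₁ ih₂ => intro σ hσ; exact .plus (ih₁ σ hσ) (ih₂ σ hσ)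
  | ident hF _ ih => intro σ hσ; exact .ident hF (ih σ hσ)
  | single hF _ ih => intro σ hσ; exact .single hF (ih σ hσ)
  | act a hF _ ih => intro σ hσ; exact .act a hF (ih σ hσ)
  | fst hF _ ih => intro σ hσ; exact .fst hF (ih σ hσ)
  | snd hF _ ih => intro σ hσ; exact .snd hF (ih σ hσ)
  | inl hF _ ih => intro σ hσ; exact .inl hF (ih σ hσ)
  | inr hF _ ih => intro σ hσ; exact .inr hF (ih σ hσ)


/-- The unfolding of a fixed point in `Exp_{F ◁ G}` is again in `Exp_{F ◁ G}`. -/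
theorem IsExp.unfold {G F : NDF B A} {x : X} {e : Term B A X} (h : IsExp G F (.mu x e)) :
    IsExp G F (e.subst x (.mu x e)) := by
  obtain ⟨hc, he, ht⟩ := h
  have hG : Typed G (e.subst x (.mu x e)) G := by
    refine ht.of_mu.1.bind _ fun w => ?_
    by_cases hw : w = x
    · subst hw; rw [Function.update_self]; exact .mu _ ht.of_mu.1
    · rw [Function.update_of_ne hw]; exact .var w
  refine ⟨?_, ?_, ?_⟩
  · refine Finset.eq_empty_of_forall_notMem fun v hv => ?_
    obtain ⟨w, hw, hv⟩ := e.mem_fv_bind _ hv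
    by_cases hwx : w = x
    · subst hwx
      rw [Function.update_self, hc] at hv
      simp at hv
    · have : w ∈ (Term.mu x e).fv := by simp [Term.fv, hw, hwx]
      rw [hc] at this
      simp at this
  · refine he.2.bind _ fun w => ?_
    by_cases hw : w = x
    · subst hw; rw [Function.update_self]; exact he
    · rw [Function.update_of_ne hw]; trivial
  · rcases ht.of_mu.2 with h | h
    · rw [h]; exact hG
    · subst h; exact .ident ht.ingredient hG

/-- The empty `G`-expression. -/
def Exp.emp {G : NDF B A} : Exp X G G :=
  ⟨.emp, rfl, trivial, .emp Relation.ReflTransGen.refl⟩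

/-- The sum of two `G`-expressions. -/
def Exp.plus {G : NDF B A} (e₁ e₂ : Exp X G G) : Exp X G G :=
  ⟨.plus e₁.1 e₂.1, by simp [Term.fv, e₁.2.1, e₂.2.1], ⟨e₁.2.2.1, e₂.2.2.1⟩,
    .plus e₁.2.2.2 e₂.2.2.2⟩

variable [∀ i, SemilatticeSup (B i)] [∀ i, OrderBot (B i)]

/-- The clauses of `δ_{F ◁ G}` for the empty expression, sums and fixed points; the clauses `atom`
for the other forms of expressions are supplied below. -/
noncomputable def deltaLayer (G F : NDF B A)
    (atom : (e : Term B A X) → IsExp G F e → F.obj (Exp X G G)) :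
    (e : Term B A X) → IsExp G F e → F.obj (Exp X G G)
  | .emp, _ => F.empty Exp.emp
  | .plus e₁ e₂, h =>
      F.plus Exp.plus
        (deltaLayer G F atom e₁ h.of_plus_left)
        (deltaLayer G F atom e₂ h.of_plus_right)
  | .mu x e, h => deltaLayer G F atom (e.subst x (.mu x e)) h.unfold
  | e, h => atom e h
termination_by e => e.depth
decreasing_by
  · simp only [Term.depth]; omega
  · simp only [Term.depth]; omega
  · rw [Term.subst, h.2.1.1.depth_bind]; simp only [Term.depth]; omega

open Classical in
/-- The map `δ_{id ◁ G} : Exp_{id ◁ G} → Exp_G`. -/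
noncomputable def deltaId (G : NDF B A) (e : Term B A X) (h : IsExp G .id e) : Exp X G G :=
  if G = .id then deltaLayer G .id (fun _ _ => (Exp.emp : Exp X G G)) e h else ⟨e, h.of_ident⟩

open Classical in
/-- The map `δ_{F ◁ G} : Exp_{F ◁ G} → F(Exp_G)`. The clauses `_, _` concern forms of expressions
that the typing excludes or that `deltaLayer` has already treated; their values are irrelevant. -/
noncomputable def delta (G : NDF B A) :
    (F : NDF B A) → (e : Term B A X) → IsExp G F e → F.obj (Exp X G G)
  | .id => deltaId G
  | .const i => deltaLayer G (.const i) fun e h =>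
      match e, h with
      | .const _ b, h => (h.2.2.of_const ▸ b : B i)
      | _, _ => (⊥ : B i)
  | .prod F₁ F₂ => deltaLayer G (.prod F₁ F₂) fun e h =>
      match e, h with
      | .fst e, h => (delta G F₁ e h.of_fst, F₂.empty Exp.emp)
      | .snd e, h => (F₁.empty Exp.emp, delta G F₂ e h.of_snd)
      | _, _ => (F₁.empty Exp.emp, F₂.empty Exp.emp)
  | .sum F₁ F₂ => deltaLayer G (.sum F₁ F₂) fun e h =>
      match e, h with
      | .inl e, h => DPlus.inl (delta G F₁ e h.of_inl)
      | .inr e, h => DPlus.inr (delta G F₂ e h.of_inr)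
      | _, _ => DPlus.bot
  | .pow F k => deltaLayer G (.pow F k) fun e h =>
      match e, h with
      | .act k' a e, h => fun a' : A k =>
          if (⟨k', a⟩ : Σ k, A k) = ⟨k, a'⟩ then delta G F e h.of_act
          else F.empty Exp.emp
      | _, _ => fun _ => F.empty Exp.emp
  | .pset F => deltaLayer G (.pset F) fun e h =>
      match e, h with
      | .single e, h => ⟨{delta G F e h.of_single}, Set.finite_singleton _⟩
      | _, _ => ⟨∅, Set.finite_empty⟩

/-- The coalgebra structure `δ_G : Exp_G → G(Exp_G)`. -/
noncomputable def deltaG (G : NDF B A) (e : Exp X G G) : G.obj (Exp X G G) :=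
  delta G G e.1 e.2

/-- The unconditional identities of the axiomatization, on untyped terms. -/
inductive Identity : Term B A X → Term B A X → Prop
  | idempotency (e) : Identity (.plus e e) e
  | commutativity (e₁ e₂) : Identity (.plus e₁ e₂) (.plus e₂ e₁)
  | associativity (e₁ e₂ e₃) :
      Identity (.plus e₁ (.plus e₂ e₃)) (.plus (.plus e₁ e₂) e₃)
  | empty (e) : Identity (.plus .emp e) e
  | fp (x) (e) : Identity (e.subst x (.mu x e)) (.mu x e)
  | const_emp (i) : Identity .emp (.const i ⊥)
  | const_plus (i) (b₁ b₂ : B i) :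
      Identity (.plus (.const i b₁) (.const i b₂)) (.const i (b₁ ⊔ b₂))
  | fst_emp : Identity (.fst .emp) .emp
  | fst_plus (e₁ e₂) : Identity (.fst (.plus e₁ e₂)) (.plus (.fst e₁) (.fst e₂))
  | snd_emp : Identity (.snd .emp) .emp
  | snd_plus (e₁ e₂) : Identity (.snd (.plus e₁ e₂)) (.plus (.snd e₁) (.snd e₂))
  | act_emp (k) (a : A k) : Identity (.act k a .emp) .emp
  | act_plus (k) (a : A k) (e₁ e₂) :
      Identity (.act k a (.plus e₁ e₂)) (.plus (.act k a e₁) (.act k a e₂))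
  | inl_plus (e₁ e₂) : Identity (.inl (.plus e₁ e₂)) (.plus (.inl e₁) (.inl e₂))
  | inr_plus (e₁ e₂) : Identity (.inr (.plus e₁ e₂)) (.plus (.inr e₁) (.inr e₂))
  | inl_inr (e₁ e₂) : Identity (.plus (.inl e₁) (.inr e₂)) (.plus (.inl .emp) (.inr .emp))
  | alpha (x y) (e) (hy : y ∉ e.fv) : Identity (.mu x e) (.mu y (e.subst x (.var y)))

/-- `ProvEq G F e₁ e₂` is provable equality `e₁ ≡ e₂` of elements of `Exp_{F ◁ G}`: the relations
for all types `F ◁ G` are jointly the least equivalence relations that contain the identities and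
are closed under uniqueness of fixed points and under congruence. -/
inductive ProvEq (G : NDF B A) : NDF B A → Term B A X → Term B A X → Prop
  | refl {F e} : IsExp G F e → ProvEq G F e e
  | symm {F e₁ e₂} : ProvEq G F e₁ e₂ → ProvEq G F e₂ e₁
  | trans {F e₁ e₂ e₃} : ProvEq G F e₁ e₂ → ProvEq G F e₂ e₃ → ProvEq G F e₁ e₃
  | identity {F e₁ e₂} :
      IsExp G F e₁ → IsExp G F e₂ → Identity e₁ e₂ → ProvEq G F e₁ e₂
  | unique {F x} {c e : Term B A X} : IsExp G F (.mu x c) →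
      ProvEq G F (c.subst x e) e → ProvEq G F (.mu x c) e
  | cong {F F' x} {e e₁ e₂ : Term B A X} : e.IsExpr → x ∈ e.fv →
      IsExp G F (e.subst x e₁) → IsExp G F (e.subst x e₂) →
      ProvEq G F' e₁ e₂ → ProvEq G F (e.subst x e₁) (e.subst x e₂)

end Expressions

end NDCoalg

/-! If `G` is `Id`, the unguarded layer of a closed expression consists of `∅`, `⊕` and `μ` only,
and `ProvEq.eq_emp` collapses every closed expression to `∅`.

Let `G ≠ Id`. An element of `F(Y)` can be written as a term as soon as every element of `Y` is given
one (`NDF.toTerm`), and by `ProvEq.toTerm_delta` every expression is provably equal to the term that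
describes its derivative. A family of expressions closed under derivatives is therefore a solution,
up to `≡`, of a system of equations `x p = u p` with `u p` in `G(P)`. Such a system is guarded
because `G ≠ Id`. If `P` is finite, its solutions are provably unique (`ProvEq.of_system`): the
unknowns are eliminated one by one with `μ`, and the rule (Unique) identifies each component of any
solution with the resulting expression.

It remains to extract from a bisimulation one finite system that is solved both by the first and by
the second components. By `Exp.exists_finite_span`, all iterated derivatives of an expression are
sums of finitely many fixed terms. There are infinitely many such sums, but by
`SumTree.provEq_of_lowerPart_eq` a sum is determined up to `≡` by the set of those terms that lie
provably below it. Hence the pairs of the bisimulation whose components are such sums fall into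
finitely many classes, and pairs in one class have provably equal components. A representative is
chosen in each class, and the bisimulation witness for its derivatives, read modulo classes, is the
right-hand side of the equation. Derivatives are taken at representatives only, so it is never
needed that `δ` respects `≡`. -/

namespace NDCoalg

/-! ### Substitutions without capture -/

section Substitution

variable {ι κ : Type u} {B : ι → Type u} {A : κ → Type u} {X : Type u}
  [DecidableEq X]

/-- A substitution each of whose values is closed or an unchanged variable; it captures nothing. -/
def SafeSubst (σ : X → Term B A X) : Prop :=
  ∀ w, σ w = .var w ∨ (σ w).fv = ∅

theorem SafeSubst.var : SafeSubst (Term.var : X → Term B A X) := fun _ => .inl rfl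

theorem SafeSubst.update {σ : X → Term B A X} (hσ : SafeSubst σ) (y : X) {d : Term B A X}
    (hd : d = .var y ∨ d.fv = ∅) : SafeSubst (Function.update σ y d) := by
  intro w
  by_cases hw : w = y
  · subst hw; simpa using hd
  · simpa [hw] using hσ w

variable [Infinite X]

theorem Term.bind_congr {e : Term B A X} :
    ∀ {σ τ : X → Term B A X}, (∀ w ∈ e.fv, σ w = τ w) → e.bind σ = e.bind τ := by
  induction e with
  | emp => intros; rfl
  | const => intros; rfl
  | var x => intro σ τ h; exact h x (by simp [Term.fv])
  | plus e₁ e₂ ih₁ ih₂ =>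
    intro σ τ h
    simp only [Term.fv, Finset.mem_union] at h
    simp only [Term.bind, ih₁ fun w hw => h w (.inl hw), ih₂ fun w hw => h w (.inr hw)]
  | mu y e ih =>
    intro σ τ h
    simp only [Term.fv] at h
    have : (e.fv.erase y).biUnion (fun w => (σ w).fv) =
        (e.fv.erase y).biUnion fun w => (τ w).fv :=
      Finset.biUnion_congr rfl fun w hw => by rw [h w hw]
    simp only [Term.bind, this]
    congr 1
    refine ih fun w hw => ?_
    by_cases hwy : w = y
    · subst hwy; simp
    · simpa [hwy] using h w (by simp [hw, hwy])
  | fst e ih => intro σ τ h; simp only [Term.bind, ih h]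
  | snd e ih => intro σ τ h; simp only [Term.bind, ih h]
  | inl e ih => intro σ τ h; simp only [Term.bind, ih h]
  | inr e ih => intro σ τ h; simp only [Term.bind, ih h]
  | act k a e ih => intro σ τ h; simp only [Term.bind, ih h]
  | single e ih => intro σ τ h; simp only [Term.bind, ih h]

/-- No value of `σ` at another variable contains `y`, so the binder keeps its name. This makes the
substitution laws below syntactic equalities, with no appeal to α-conversion. -/
theorem SafeSubst.bind_mu {σ : X → Term B A X} (hσ : SafeSubst σ) (y : X) (e : Term B A X) :
    (Term.mu y e).bind σ = .mu y (e.bind (Function.update σ y (.var y))) := by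
  have : y ∉ (e.fv.erase y).biUnion fun w => (σ w).fv := by
    simp only [Finset.mem_biUnion, Finset.mem_erase, not_exists, not_and]
    rintro w ⟨hw, -⟩
    rcases hσ w with h | h
    · simpa [h, Term.fv] using Ne.symm hw
    · simp [h]
  simp only [Term.bind, rename, if_neg this]

theorem Term.bind_var (e : Term B A X) : e.bind .var = e := by
  induction e with
  | mu y e ih => rw [SafeSubst.var.bind_mu, Function.update_eq_self, ih]
  | _ => simp_all [Term.bind]

theorem Term.bind_of_closed {e : Term B A X} (h : e.fv = ∅) (σ : X → Term B A X) :
    e.bind σ = e :=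
  (Term.bind_congr fun w hw => by simp [h] at hw).trans e.bind_var

theorem SafeSubst.comp {σ τ : X → Term B A X} (hσ : SafeSubst σ) (hτ : SafeSubst τ) :
    SafeSubst fun w => (σ w).bind τ := by
  intro w
  dsimp only
  rcases hσ w with h | h
  · rw [h]; exact hτ w
  · rw [Term.bind_of_closed h]; exact .inr h

theorem SafeSubst.bind_bind {e : Term B A X} :
    ∀ {σ τ : X → Term B A X}, SafeSubst σ → SafeSubst τ →
      (e.bind σ).bind τ = e.bind fun w => (σ w).bind τ := by
  induction e with
  | emp => intros; rfl
  | const => intros; rfl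
  | var x => intros; rfl
  | mu y e ih =>
    intro σ τ hσ hτ
    rw [hσ.bind_mu, hτ.bind_mu, (hσ.comp hτ).bind_mu,
      ih (hσ.update y (.inl rfl)) (hτ.update y (.inl rfl))]
    congr 2
    funext w
    by_cases hw : w = y
    · subst hw; simp [Term.bind]
    · simp only [Function.update_of_ne hw]
      rcases hσ w with h | h
      · simp [h, Term.bind, hw]
      · rw [Term.bind_of_closed h, Term.bind_of_closed h]
  | plus e₁ e₂ ih₁ ih₂ => intro σ τ hσ hτ; simp only [Term.bind, ih₁ hσ hτ, ih₂ hσ hτ]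
  | fst e ih => intro σ τ hσ hτ; simp only [Term.bind, ih hσ hτ]
  | snd e ih => intro σ τ hσ hτ; simp only [Term.bind, ih hσ hτ]
  | inl e ih => intro σ τ hσ hτ; simp only [Term.bind, ih hσ hτ]
  | inr e ih => intro σ τ hσ hτ; simp only [Term.bind, ih hσ hτ]
  | act k a e ih => intro σ τ hσ hτ; simp only [Term.bind, ih hσ hτ]
  | single e ih => intro σ τ hσ hτ; simp only [Term.bind, ih hσ hτ]

/-- This computes the unfolding of an instantiated fixed point: instantiating the body and then
substituting for the bound variable is a single substitution. -/
theorem SafeSubst.subst_bind {σ : X → Term B A X} (hσ : SafeSubst σ) (e : Term B A X) (x : X)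
    {d : Term B A X} (hd : d.fv = ∅) :
    (e.bind (Function.update σ x (.var x))).subst x d = e.bind (Function.update σ x d) := by
  rw [Term.subst, SafeSubst.bind_bind (hσ.update x (.inl rfl)) (SafeSubst.var.update x (.inr hd))]
  congr 1
  funext w
  by_cases hw : w = x
  · subst hw; simp [Term.bind]
  · simp only [Function.update_of_ne hw]
    rcases hσ w with h | h
    · simp [h, Term.bind, hw]
    · exact Term.bind_of_closed h _

end Substitution

/-! ### Finite sums of terms -/

section Sums

variable {ι κ : Type u} {B : ι → Type u} {A : κ → Type u} {X : Type u}

theorem NDF.Step.ingredient {F F' G : NDF B A} (h : NDF.Step F F') (h' : F'.Ingredient G) :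
    F.Ingredient G :=
  (Relation.ReflTransGen.single h).trans h'

/-- Finite sums of expressions. -/
def Term.sum : List (Term B A X) → Term B A X
  | [] => .emp
  | e :: l => .plus e (Term.sum l)

theorem Term.isGuarded_sum {l : List (Term B A X)} (hl : ∀ e ∈ l, e.IsGuarded) :
    (Term.sum l).IsGuarded := by
  induction l with
  | nil => trivial
  | cons e l ih => exact ⟨hl e (by simp), ih fun d hd => hl d (by simp [hd])⟩

theorem Term.isExpr_sum {l : List (Term B A X)} (hl : ∀ e ∈ l, e.IsExpr) :
    (Term.sum l).IsExpr := by
  induction l with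
  | nil => trivial
  | cons e l ih => exact ⟨hl e (by simp), ih fun d hd => hl d (by simp [hd])⟩

theorem Typed.sum {G F : NDF B A} (hF : F.Ingredient G) {l : List (Term B A X)}
    (hl : ∀ e ∈ l, Typed G e F) : Typed G (Term.sum l) F := by
  induction l with
  | nil => exact .emp hF
  | cons e l ih => exact .plus (hl e (by simp)) (ih fun d hd => hl d (by simp [hd]))

variable [DecidableEq X]

theorem Term.mem_fv_sum {z : X} {l : List (Term B A X)} (h : z ∈ (Term.sum l).fv) :
    ∃ e ∈ l, z ∈ e.fv := by
  induction l with
  | nil => simp [Term.sum, Term.fv] at h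
  | cons e l ih =>
    rcases Finset.mem_union.mp h with h | h
    · exact ⟨e, by simp, h⟩
    · obtain ⟨d, hd, hz⟩ := ih h
      exact ⟨d, by simp [hd], hz⟩

variable [Infinite X]

theorem Term.sum_bind (l : List (Term B A X)) (σ : X → Term B A X) :
    (Term.sum l).bind σ = Term.sum (l.map fun e => e.bind σ) := by
  induction l with
  | nil => rfl
  | cons e l ih => simp only [Term.sum, Term.bind, List.map_cons, ih]

end Sums

/-! ### Congruence rules and the semilattice order of provable equality -/

section Provable

variable {ι κ : Type u} {B : ι → Type u} {A : κ → Type u} {X : Type u}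
  [DecidableEq X]

theorem IsExp.emp {G F : NDF B A} (hF : F.Ingredient G) : IsExp G F (.emp : Term B A X) :=
  ⟨rfl, trivial, .emp hF⟩

theorem IsExp.plus {G F : NDF B A} {a b : Term B A X} (ha : IsExp G F a) (hb : IsExp G F b) :
    IsExp G F (.plus a b) :=
  ⟨by simp [Term.fv, ha.1, hb.1], ⟨ha.2.1, hb.2.1⟩, .plus ha.2.2 hb.2.2⟩

theorem IsExp.ingredient {G F : NDF B A} {a : Term B A X} (ha : IsExp G F a) : F.Ingredient G :=
  ha.2.2.ingredient

theorem IsExp.const {G : NDF B A} {i : ι} (hF : (NDF.const i).Ingredient G) (b : B i) :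
    IsExp G (.const i) (.const i b : Term B A X) :=
  ⟨rfl, trivial, .const i b hF⟩

theorem IsExp.fst {G F₁ F₂ : NDF B A} {a : Term B A X} (hF : (F₁.prod F₂).Ingredient G)
    (ha : IsExp G F₁ a) : IsExp G (F₁.prod F₂) (.fst a) :=
  ⟨ha.1, ha.2.1, .fst hF ha.2.2⟩

theorem IsExp.snd {G F₁ F₂ : NDF B A} {a : Term B A X} (hF : (F₁.prod F₂).Ingredient G)
    (ha : IsExp G F₂ a) : IsExp G (F₁.prod F₂) (.snd a) :=
  ⟨ha.1, ha.2.1, .snd hF ha.2.2⟩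

theorem IsExp.inl {G F₁ F₂ : NDF B A} {a : Term B A X} (hF : (F₁.sum F₂).Ingredient G)
    (ha : IsExp G F₁ a) : IsExp G (F₁.sum F₂) (.inl a) :=
  ⟨ha.1, ha.2.1, .inl hF ha.2.2⟩

theorem IsExp.inr {G F₁ F₂ : NDF B A} {a : Term B A X} (hF : (F₁.sum F₂).Ingredient G)
    (ha : IsExp G F₂ a) : IsExp G (F₁.sum F₂) (.inr a) :=
  ⟨ha.1, ha.2.1, .inr hF ha.2.2⟩

theorem IsExp.act {G F : NDF B A} {k : κ} {a : Term B A X} (hF : (F.pow k).Ingredient G)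
    (ha : IsExp G F a) (c : A k) : IsExp G (F.pow k) (.act k c a) :=
  ⟨ha.1, ha.2.1, .act c hF ha.2.2⟩

theorem IsExp.single {G F : NDF B A} {a : Term B A X} (hF : F.pset.Ingredient G)
    (ha : IsExp G F a) : IsExp G F.pset (.single a) :=
  ⟨ha.1, ha.2.1, .single hF ha.2.2⟩

theorem IsExp.ident {G : NDF B A} {a : Term B A X} (hF : NDF.id.Ingredient G)
    (ha : IsExp G G a) : IsExp G .id a :=
  ⟨ha.1, ha.2.1, .ident hF ha.2.2⟩

theorem IsExp.sum {G F : NDF B A} (hF : F.Ingredient G) {l : List (Term B A X)}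
    (hl : ∀ e ∈ l, IsExp G F e) : IsExp G F (Term.sum l) := by
  induction l with
  | nil => exact .emp hF
  | cons e l ih =>
    exact (hl e (by simp)).plus (ih fun d hd => hl d (by simp [hd]))

variable [Infinite X] [∀ i, SemilatticeSup (B i)] [∀ i, OrderBot (B i)]

theorem ProvEq.isExp {G F : NDF B A} {a b : Term B A X} (h : ProvEq G F a b) :
    IsExp G F a ∧ IsExp G F b := by
  induction h with
  | refl h => exact ⟨h, h⟩
  | symm _ ih => exact ih.symm
  | trans _ _ ih₁ ih₂ => exact ⟨ih₁.1, ih₂.2⟩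
  | identity h₁ h₂ _ => exact ⟨h₁, h₂⟩
  | unique h _ ih => exact ⟨h, ih.2⟩
  | cong _ _ h₁ h₂ _ _ => exact ⟨h₁, h₂⟩

/-- The rule (Cong) in usable form: the context is a function `C`, and `e` with its hole `x` merely
presents it. The two types may differ, as they do for the guarding constructors. -/
theorem ProvEq.congr_context {G F F' : NDF B A} {a b : Term B A X}
    (h : ProvEq G F' a b) {C : Term B A X → Term B A X} (x : X) (e : Term B A X) (he : e.IsExpr)
    (hx : x ∈ e.fv) (hC : ∀ d, e.subst x d = C d) (ha : IsExp G F (C a)) (hb : IsExp G F (C b)) :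
    ProvEq G F (C a) (C b) := by
  rw [← hC, ← hC] at *
  exact .cong he hx ha hb h

theorem ProvEq.fst {G F₁ F₂ : NDF B A} {a b : Term B A X} (hF : (F₁.prod F₂).Ingredient G)
    (h : ProvEq G F₁ a b) : ProvEq G (F₁.prod F₂) (.fst a) (.fst b) :=
  have x : X := Classical.arbitrary X
  h.congr_context x (.fst (.var x)) trivial (by simp [Term.fv])
    (fun d => by simp [Term.subst, Term.bind]) (h.isExp.1.fst hF) (h.isExp.2.fst hF)

theorem ProvEq.snd {G F₁ F₂ : NDF B A} {a b : Term B A X} (hF : (F₁.prod F₂).Ingredient G)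
    (h : ProvEq G F₂ a b) : ProvEq G (F₁.prod F₂) (.snd a) (.snd b) :=
  have x : X := Classical.arbitrary X
  h.congr_context x (.snd (.var x)) trivial (by simp [Term.fv])
    (fun d => by simp [Term.subst, Term.bind]) (h.isExp.1.snd hF) (h.isExp.2.snd hF)

theorem ProvEq.inl {G F₁ F₂ : NDF B A} {a b : Term B A X} (hF : (F₁.sum F₂).Ingredient G)
    (h : ProvEq G F₁ a b) : ProvEq G (F₁.sum F₂) (.inl a) (.inl b) :=
  have x : X := Classical.arbitrary X
  h.congr_context x (.inl (.var x)) trivial (by simp [Term.fv])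
    (fun d => by simp [Term.subst, Term.bind]) (h.isExp.1.inl hF) (h.isExp.2.inl hF)

theorem ProvEq.inr {G F₁ F₂ : NDF B A} {a b : Term B A X} (hF : (F₁.sum F₂).Ingredient G)
    (h : ProvEq G F₂ a b) : ProvEq G (F₁.sum F₂) (.inr a) (.inr b) :=
  have x : X := Classical.arbitrary X
  h.congr_context x (.inr (.var x)) trivial (by simp [Term.fv])
    (fun d => by simp [Term.subst, Term.bind]) (h.isExp.1.inr hF) (h.isExp.2.inr hF)

theorem ProvEq.act {G F : NDF B A} {k : κ} {a b : Term B A X} (hF : (F.pow k).Ingredient G)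
    (h : ProvEq G F a b) (c : A k) : ProvEq G (F.pow k) (.act k c a) (.act k c b) :=
  have x : X := Classical.arbitrary X
  h.congr_context x (.act k c (.var x)) trivial (by simp [Term.fv])
    (fun d => by simp [Term.subst, Term.bind]) (h.isExp.1.act hF c) (h.isExp.2.act hF c)

theorem ProvEq.single {G F : NDF B A} {a b : Term B A X} (hF : F.pset.Ingredient G)
    (h : ProvEq G F a b) : ProvEq G F.pset (.single a) (.single b) :=
  have x : X := Classical.arbitrary X
  h.congr_context x (.single (.var x)) trivial (by simp [Term.fv])
    (fun d => by simp [Term.subst, Term.bind]) (h.isExp.1.single hF) (h.isExp.2.single hF)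

theorem ProvEq.ident {G : NDF B A} {a b : Term B A X} (hF : NDF.id.Ingredient G)
    (h : ProvEq G G a b) : ProvEq G .id a b :=
  have x : X := Classical.arbitrary X
  h.congr_context (C := fun d => d) x (.var x) trivial (by simp [Term.fv])
    (fun d => by simp [Term.subst, Term.bind]) (h.isExp.1.ident hF) (h.isExp.2.ident hF)

theorem ProvEq.comm {G F : NDF B A} {a b : Term B A X} (ha : IsExp G F a) (hb : IsExp G F b) :
    ProvEq G F (.plus a b) (.plus b a) :=
  .identity (ha.plus hb) (hb.plus ha) (.commutativity a b)

theorem ProvEq.assoc {G F : NDF B A} {a b c : Term B A X} (ha : IsExp G F a) (hb : IsExp G F b)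
    (hc : IsExp G F c) : ProvEq G F (.plus a (.plus b c)) (.plus (.plus a b) c) :=
  .identity (ha.plus (hb.plus hc)) ((ha.plus hb).plus hc) (.associativity a b c)

theorem ProvEq.idem {G F : NDF B A} {a : Term B A X} (ha : IsExp G F a) :
    ProvEq G F (.plus a a) a :=
  .identity (ha.plus ha) ha (.idempotency a)

theorem ProvEq.emp_plus {G F : NDF B A} {a : Term B A X} (ha : IsExp G F a) :
    ProvEq G F (.plus .emp a) a :=
  .identity ((IsExp.emp ha.ingredient).plus ha) ha (.empty a)

theorem ProvEq.plus_left {G F : NDF B A} {a b c : Term B A X} (h : ProvEq G F a b)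
    (hc : IsExp G F c) : ProvEq G F (.plus a c) (.plus b c) :=
  have x : X := Classical.arbitrary X
  h.congr_context (C := fun d => .plus d c) x (.plus (.var x) c) ⟨trivial, hc.2.1⟩
    (by simp [Term.fv]) (fun d => by simp [Term.subst, Term.bind, Term.bind_of_closed hc.1])
    (h.isExp.1.plus hc) (h.isExp.2.plus hc)

theorem ProvEq.plus {G F : NDF B A} {a b c d : Term B A X} (h : ProvEq G F a b)
    (h' : ProvEq G F c d) : ProvEq G F (.plus a c) (.plus b d) :=
  (h.plus_left h'.isExp.1).trans <| (comm h.isExp.2 h'.isExp.1).trans <|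
    (h'.plus_left h.isExp.2).trans <| comm h'.isExp.2 h.isExp.2

theorem ProvEq.plus_plus_plus_comm {G F : NDF B A} {a b c d : Term B A X} (ha : IsExp G F a)
    (hb : IsExp G F b) (hc : IsExp G F c) (hd : IsExp G F d) :
    ProvEq G F (.plus (.plus a b) (.plus c d)) (.plus (.plus a c) (.plus b d)) := by
  have h₁ := (assoc (ha.plus hb) hc hd)
  have h₂ : ProvEq G F (.plus (.plus a b) c) (.plus (.plus a c) b) :=
    (assoc ha hb hc).symm.trans <|
      ((ProvEq.refl ha).plus (comm hb hc)).trans (assoc ha hc hb)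
  exact h₁.trans <| (h₂.plus_left hd).trans (assoc (ha.plus hc) hb hd).symm

/-- The order on expressions induced by the sum. -/
def ProvLe (G F : NDF B A) (a b : Term B A X) : Prop :=
  ProvEq G F (.plus a b) b

theorem ProvLe.isExp {G F : NDF B A} {a b : Term B A X} (h : ProvLe G F a b) :
    IsExp G F a ∧ IsExp G F b :=
  ⟨(ProvEq.isExp h).1.of_plus_left, (ProvEq.isExp h).2⟩

theorem ProvEq.le {G F : NDF B A} {a b : Term B A X} (h : ProvEq G F a b) : ProvLe G F a b :=
  (h.plus_left h.isExp.2).trans (idem h.isExp.2)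

theorem ProvLe.antisymm {G F : NDF B A} {a b : Term B A X} (h : ProvLe G F a b)
    (h' : ProvLe G F b a) : ProvEq G F a b :=
  (ProvEq.symm h').trans <| (ProvEq.comm h.isExp.2 h.isExp.1).trans h

theorem ProvLe.trans {G F : NDF B A} {a b c : Term B A X} (h : ProvLe G F a b)
    (h' : ProvLe G F b c) : ProvLe G F a c :=
  ((ProvEq.refl h.isExp.1).plus (.symm h')).trans <|
    (ProvEq.assoc h.isExp.1 h'.isExp.1 h'.isExp.2).trans <|
      (ProvEq.plus_left h h'.isExp.2).trans h'

theorem ProvLe.emp {G F : NDF B A} {a : Term B A X} (ha : IsExp G F a) : ProvLe G F .emp a :=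
  ProvEq.emp_plus ha

theorem ProvLe.plus_left {G F : NDF B A} {a b : Term B A X} (ha : IsExp G F a)
    (hb : IsExp G F b) : ProvLe G F a (.plus a b) :=
  (ProvEq.assoc ha ha hb).trans ((ProvEq.idem ha).plus_left hb)

theorem ProvLe.plus_right {G F : NDF B A} {a b : Term B A X} (ha : IsExp G F a)
    (hb : IsExp G F b) : ProvLe G F b (.plus a b) :=
  (ProvLe.plus_left hb ha).trans (ProvEq.comm hb ha).le

theorem ProvLe.plus {G F : NDF B A} {a b c : Term B A X} (ha : ProvLe G F a c)
    (hb : ProvLe G F b c) : ProvLe G F (.plus a b) c :=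
  (ProvEq.assoc ha.isExp.1 hb.isExp.1 ha.isExp.2).symm.trans <|
    ((ProvEq.refl ha.isExp.1).plus hb).trans ha

theorem ProvLe.sum_le {G F : NDF B A} {l : List (Term B A X)} {b : Term B A X} (hb : IsExp G F b)
    (hl : ∀ e ∈ l, ProvLe G F e b) : ProvLe G F (Term.sum l) b := by
  induction l with
  | nil => exact .emp hb
  | cons e l ih =>
    exact (hl e (by simp)).plus (ih fun d hd => hl d (by simp [hd]))

theorem ProvLe.le_sum {G F : NDF B A} {l : List (Term B A X)} (hl : ∀ e ∈ l, IsExp G F e)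
    {e : Term B A X} (he : e ∈ l) : ProvLe G F e (Term.sum l) := by
  induction l with
  | nil => simp at he
  | cons d l ih =>
    have hd : IsExp G F d := hl d (by simp)
    have hl' : ∀ e ∈ l, IsExp G F e := fun c hc => hl c (by simp [hc])
    have hs : IsExp G F (Term.sum l) := .sum hd.ingredient hl'
    rcases List.mem_cons.mp he with rfl | he
    · exact .plus_left hd hs
    · exact (ih hl' he).trans (.plus_right hd hs)

/-- A sum is the join of its summands, so order and multiplicity do not matter. This frees the
description of powers and finite sets from the arbitrary enumerations it uses. -/
theorem ProvLe.sum_mono {G F : NDF B A} (hF : F.Ingredient G) {l l' : List (Term B A X)}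
    (hl' : ∀ e ∈ l', IsExp G F e) (h : ∀ e ∈ l, ∃ d ∈ l', ProvLe G F e d) :
    ProvLe G F (Term.sum l) (Term.sum l') := by
  refine ProvLe.sum_le (.sum hF hl') fun e he => ?_
  obtain ⟨d, hd, hed⟩ := h e he
  exact hed.trans (.le_sum hl' hd)

theorem ProvEq.sum_congr {G F : NDF B A} (hF : F.Ingredient G) {l l' : List (Term B A X)}
    (h : ∀ e ∈ l, ∃ d ∈ l', ProvEq G F e d) (h' : ∀ d ∈ l', ∃ e ∈ l, ProvEq G F e d) :
    ProvEq G F (Term.sum l) (Term.sum l') := by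
  refine ProvLe.antisymm (.sum_mono hF (fun d hd => ?_) fun e he => ?_)
    (.sum_mono hF (fun e he => ?_) fun d hd => ?_)
  · obtain ⟨e, -, h⟩ := h' d hd
    exact h.isExp.2
  · obtain ⟨d, hd, h⟩ := h e he
    exact ⟨d, hd, h.le⟩
  · obtain ⟨d, -, h⟩ := h e he
    exact h.isExp.1
  · obtain ⟨e, he, h⟩ := h' d hd
    exact ⟨e, he, h.symm.le⟩

/-- The sum of `l[-]` and `r[-]` absorbs `l[-]`. -/
theorem ProvEq.inl_plus_top {G F₁ F₂ : NDF B A} (hF : (F₁.sum F₂).Ingredient G)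
    {a : Term B A X} (ha : IsExp G F₁ a) :
    ProvEq G (F₁.sum F₂) (.plus (.inl a) (.plus (.inl .emp) (.inr .emp)))
      (.plus (.inl .emp) (.inr .emp)) := by
  have h₁ : IsExp G F₁ (.emp : Term B A X) := .emp ha.ingredient
  have h₂ : IsExp G F₂ (.emp : Term B A X) := .emp ((NDF.Step.sum_right F₁ F₂).ingredient hF)
  -- `l[a] ⊕ l[∅]` merges into `l[a ⊕ ∅]`; the inconsistency identity then discards the argument `a
  -- ⊕ ∅`. Note that `l[∅]` itself is not identified with `∅`.
  refine (ProvEq.assoc (ha.inl hF) (h₁.inl hF) (h₂.inr hF)).trans ?_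
  refine (ProvEq.plus_left (.symm (.identity ((ha.plus h₁).inl hF)
    ((ha.inl hF).plus (h₁.inl hF)) (.inl_plus _ _))) (h₂.inr hF)).trans ?_
  exact .identity (((ha.plus h₁).inl hF).plus (h₂.inr hF)) ((h₁.inl hF).plus (h₂.inr hF))
    (.inl_inr _ _)

/-- The sum of `l[-]` and `r[-]` absorbs `r[-]`. -/
theorem ProvEq.inr_plus_top {G F₁ F₂ : NDF B A} (hF : (F₁.sum F₂).Ingredient G)
    {a : Term B A X} (ha : IsExp G F₂ a) :
    ProvEq G (F₁.sum F₂) (.plus (.inr a) (.plus (.inl .emp) (.inr .emp)))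
      (.plus (.inl .emp) (.inr .emp)) := by
  have h₁ : IsExp G F₁ (.emp : Term B A X) := .emp ((NDF.Step.sum_left F₁ F₂).ingredient hF)
  have h₂ : IsExp G F₂ (.emp : Term B A X) := .emp ha.ingredient
  refine (ProvEq.comm (ha.inr hF) ((h₁.inl hF).plus (h₂.inr hF))).trans ?_
  refine (ProvEq.assoc (h₁.inl hF) (h₂.inr hF) (ha.inr hF)).symm.trans ?_
  refine (ProvEq.plus (.refl (h₁.inl hF)) (.symm (.identity ((h₂.plus ha).inr hF)
    ((h₂.inr hF).plus (ha.inr hF)) (.inr_plus _ _)))).trans ?_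
  exact .identity ((h₁.inl hF).plus ((h₂.plus ha).inr hF)) ((h₁.inl hF).plus (h₂.inr hF))
    (.inl_inr _ _)

end Provable

/-! ### Elements of `F(Y)` as terms -/

section Representation

variable {ι κ : Type u} {B : ι → Type u} {A : κ → Type u} {X : Type u} [∀ k, Finite (A k)]

/-- The term describing an element of `F(Y)`, given a term `v y` for each `y`. -/
noncomputable def NDF.toTerm {Y : Type u} (v : Y → Term B A X) :
    (F : NDF B A) → F.obj Y → Term B A X
  | .id, y => v y
  | .const i, b => .const i b
  | .sum _ _, .bot => .emp
  | .sum _ _, .top => .plus (.inl .emp) (.inr .emp)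
  | .sum F₁ _, .inl c => .inl (F₁.toTerm v c)
  | .sum _ F₂, .inr c => .inr (F₂.toTerm v c)
  | .prod F₁ F₂, c => .plus (.fst (F₁.toTerm v c.1)) (.snd (F₂.toTerm v c.2))
  | .pow F k, c => Term.sum
      ((Set.finite_univ (α := A k)).toFinset.toList.map fun a => .act k a (F.toTerm v (c a)))
  | .pset F, s => Term.sum (s.2.toFinset.toList.map fun c => .single (F.toTerm v c))

theorem NDF.isGuarded_toTerm {Y : Type u} {v : Y → Term B A X} {F : NDF B A} (hF : F ≠ .id)
    (c : F.obj Y) : (F.toTerm v c).IsGuarded := by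
  cases F with
  | id => exact absurd rfl hF
  | const => trivial
  | sum => cases c <;> simp [NDF.toTerm, Term.IsGuarded]
  | prod => simp [NDF.toTerm, Term.IsGuarded]
  | pow =>
    refine Term.isGuarded_sum fun e he => ?_
    obtain ⟨a, -, rfl⟩ := List.mem_map.mp he
    trivial
  | pset =>
    refine Term.isGuarded_sum fun e he => ?_
    obtain ⟨a, -, rfl⟩ := List.mem_map.mp he
    trivial

theorem NDF.isExpr_toTerm {Y : Type u} {v : Y → Term B A X} (hv : ∀ y, (v y).IsExpr)
    (F : NDF B A) (c : F.obj Y) : (F.toTerm v c).IsExpr := by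
  induction F with
  | id => exact hv c
  | const => trivial
  | sum F₁ F₂ ih₁ ih₂ =>
    cases c with
    | bot => trivial
    | top => exact ⟨trivial, trivial⟩
    | inl c => exact ih₁ c
    | inr c => exact ih₂ c
  | prod F₁ F₂ ih₁ ih₂ => exact ⟨ih₁ _, ih₂ _⟩
  | pow F k ih =>
    refine Term.isExpr_sum fun e he => ?_
    obtain ⟨a, -, rfl⟩ := List.mem_map.mp he
    exact ih _
  | pset F ih =>
    refine Term.isExpr_sum fun e he => ?_
    obtain ⟨a, -, rfl⟩ := List.mem_map.mp he
    exact ih _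

theorem Typed.toTerm {Y : Type u} {v : Y → Term B A X} {G : NDF B A} (hv : ∀ y, Typed G (v y) G)
    (F : NDF B A) (hF : F.Ingredient G) (c : F.obj Y) : Typed G (F.toTerm v c) F := by
  induction F with
  | id => exact .ident hF (hv c)
  | const i => exact .const i c hF
  | sum F₁ F₂ ih₁ ih₂ =>
    have h₁ := (NDF.Step.sum_left F₁ F₂).ingredient hF
    have h₂ := (NDF.Step.sum_right F₁ F₂).ingredient hF
    cases c with
    | bot => exact .emp hF
    | top => exact .plus (.inl hF (.emp h₁)) (.inr hF (.emp h₂))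
    | inl c => exact .inl hF (ih₁ h₁ c)
    | inr c => exact .inr hF (ih₂ h₂ c)
  | prod F₁ F₂ ih₁ ih₂ =>
    exact .plus (.fst hF (ih₁ ((NDF.Step.prod_left F₁ F₂).ingredient hF) _))
      (.snd hF (ih₂ ((NDF.Step.prod_right F₁ F₂).ingredient hF) _))
  | pow F k ih =>
    refine Typed.sum hF fun e he => ?_
    obtain ⟨a, -, rfl⟩ := List.mem_map.mp he
    exact .act a hF (ih ((NDF.Step.pow F k).ingredient hF) _)
  | pset F ih =>
    refine Typed.sum hF fun e he => ?_
    obtain ⟨a, -, rfl⟩ := List.mem_map.mp he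
    exact .single hF (ih ((NDF.Step.pset F).ingredient hF) _)

variable [DecidableEq X]

theorem NDF.mem_fv_toTerm {Y : Type u} {v : Y → Term B A X} {z : X} (F : NDF B A) (c : F.obj Y)
    (h : z ∈ (F.toTerm v c).fv) : ∃ y, z ∈ (v y).fv := by
  induction F with
  | id => exact ⟨c, h⟩
  | const => simp [NDF.toTerm, Term.fv] at h
  | sum F₁ F₂ ih₁ ih₂ =>
    cases c with
    | bot => simp [NDF.toTerm, Term.fv] at h
    | top => simp [NDF.toTerm, Term.fv] at h
    | inl c => exact ih₁ c h
    | inr c => exact ih₂ c h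
  | prod F₁ F₂ ih₁ ih₂ =>
    rcases Finset.mem_union.mp h with h | h
    · exact ih₁ _ h
    · exact ih₂ _ h
  | pow F k ih =>
    obtain ⟨e, he, h⟩ := Term.mem_fv_sum h
    obtain ⟨a, -, rfl⟩ := List.mem_map.mp he
    exact ih _ h
  | pset F ih =>
    obtain ⟨e, he, h⟩ := Term.mem_fv_sum h
    obtain ⟨a, -, rfl⟩ := List.mem_map.mp he
    exact ih _ h

theorem IsExp.toTerm {Y : Type u} {v : Y → Term B A X} {G : NDF B A} (hv : ∀ y, IsExp G G (v y))
    {F : NDF B A} (hF : F.Ingredient G) (c : F.obj Y) : IsExp G F (F.toTerm v c) := by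
  refine ⟨Finset.eq_empty_of_forall_notMem fun z hz => ?_,
    F.isExpr_toTerm (fun y => (hv y).2.1) c, .toTerm (fun y => (hv y).2.2) F hF c⟩
  obtain ⟨y, hy⟩ := F.mem_fv_toTerm c hz
  simp [(hv y).1] at hy

variable [Infinite X]

/-- A syntactic equality, since `c`, and with it every enumeration, stays the same on both sides. -/
theorem NDF.toTerm_bind {Y : Type u} (v : Y → Term B A X) (σ : X → Term B A X) (F : NDF B A)
    (c : F.obj Y) : (F.toTerm v c).bind σ = F.toTerm (fun y => (v y).bind σ) c := by
  induction F with
  | id => rfl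
  | const => rfl
  | sum F₁ F₂ ih₁ ih₂ => cases c <;> simp only [NDF.toTerm, Term.bind, ih₁, ih₂]
  | prod F₁ F₂ ih₁ ih₂ => simp only [NDF.toTerm, Term.bind, ih₁, ih₂]
  | pow F k ih => simp only [NDF.toTerm, Term.sum_bind, List.map_map, Function.comp_def,
      Term.bind, ih]
  | pset F ih => simp only [NDF.toTerm, Term.sum_bind, List.map_map, Function.comp_def,
      Term.bind, ih]

variable [∀ i, SemilatticeSup (B i)] [∀ i, OrderBot (B i)]

/-- Naturality, but only up to `≡`: for finite powersets, taking the image under `f` may merge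
elements and changes the enumeration, which idempotency, commutativity and associativity absorb. -/
theorem ProvEq.toTerm_map {Y Z : Type u} {f : Y → Z} {v : Z → Term B A X} {w : Y → Term B A X}
    {G : NDF B A} (h : ∀ y, ProvEq G G (v (f y)) (w y)) (F : NDF B A)
    (hF : F.Ingredient G) (c : F.obj Y) :
    ProvEq G F (F.toTerm v (F.map f c)) (F.toTerm w c) := by
  induction F with
  | id => exact (h c).ident hF
  | const i => exact .refl (.const hF c)
  | sum F₁ F₂ ih₁ ih₂ =>
    have h₁ := (NDF.Step.sum_left F₁ F₂).ingredient hF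
    have h₂ := (NDF.Step.sum_right F₁ F₂).ingredient hF
    cases c with
    | bot => exact .refl (.emp hF)
    | top => exact .refl ((IsExp.inl hF (.emp h₁)).plus (.inr hF (.emp h₂)))
    | inl c => exact (ih₁ h₁ c).inl hF
    | inr c => exact (ih₂ h₂ c).inr hF
  | prod F₁ F₂ ih₁ ih₂ =>
    exact ((ih₁ ((NDF.Step.prod_left F₁ F₂).ingredient hF) _).fst hF).plus
      ((ih₂ ((NDF.Step.prod_right F₁ F₂).ingredient hF) _).snd hF)
  | pow F k ih =>
    have ih := fun a => (ih ((NDF.Step.pow F k).ingredient hF) (c a)).act hF a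
    refine ProvEq.sum_congr hF ?_ ?_
    · simp only [List.mem_map]
      rintro _ ⟨a, ha, rfl⟩
      exact ⟨_, ⟨a, ha, rfl⟩, ih a⟩
    · simp only [List.mem_map]
      rintro _ ⟨a, ha, rfl⟩
      exact ⟨_, ⟨a, ha, rfl⟩, ih a⟩
  | pset F ih =>
    have ih := fun d => (ih ((NDF.Step.pset F).ingredient hF) d).single hF
    refine ProvEq.sum_congr hF ?_ ?_
    · simp only [List.mem_map, Finset.mem_toList, Set.Finite.mem_toFinset]
      rintro _ ⟨_, ⟨d, hd, rfl⟩, rfl⟩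
      exact ⟨_, ⟨d, hd, rfl⟩, ih d⟩
    · simp only [List.mem_map, Finset.mem_toList, Set.Finite.mem_toFinset]
      rintro _ ⟨d, hd, rfl⟩
      exact ⟨_, ⟨_, ⟨d, hd, rfl⟩, rfl⟩, ih d⟩

theorem ProvEq.toTerm_congr {Y : Type u} {v w : Y → Term B A X} {G : NDF B A}
    (h : ∀ y, ProvEq G G (v y) (w y)) (F : NDF B A) (hF : F.Ingredient G) (c : F.obj Y) :
    ProvEq G F (F.toTerm v c) (F.toTerm w c) :=
  -- Both sides are compared with the description of `F.map (fun y => y) c`.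
  have hv : ∀ y, ProvEq G G (v y) (v y) := fun y => .refl (h y).isExp.1
  ((ProvEq.toTerm_map (f := fun y => y) hv F hF c).symm.trans
    (ProvEq.toTerm_map (f := fun y => y) h F hF c))

theorem ProvEq.toTerm_empty {Y : Type u} {v : Y → Term B A X} {G : NDF B A} {z : Y}
    (hz : v z = .emp) (F : NDF B A) (hF : F.Ingredient G) :
    ProvEq G F .emp (F.toTerm v (F.empty z)) := by
  induction F with
  | id =>
    simp only [NDF.toTerm, NDF.empty, hz]
    exact .refl (.emp hF)
  | const i => exact .identity (.emp hF) (.const hF _) (.const_emp i)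
  | sum F₁ F₂ => exact .refl (.emp hF)
  | prod F₁ F₂ ih₁ ih₂ =>
    have h₁ := (NDF.Step.prod_left F₁ F₂).ingredient hF
    have h₂ := (NDF.Step.prod_right F₁ F₂).ingredient hF
    have e₁ : ProvEq G _ _ _ := .identity (.fst hF (.emp h₁)) (.emp hF) (.fst_emp (X := X))
    have e₂ : ProvEq G _ _ _ := .identity (.snd hF (.emp h₂)) (.emp hF) (.snd_emp (X := X))
    exact (ProvEq.idem (.emp hF)).symm.trans
      ((e₁.symm.trans ((ih₁ h₁).fst hF)).plus (e₂.symm.trans ((ih₂ h₂).snd hF)))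
  | pow F k ih =>
    have h := (NDF.Step.pow F k).ingredient hF
    have key : ∀ a : A k, ProvEq G (.pow F k) .emp (.act k a (F.toTerm v (F.empty z))) :=
      fun a => (ProvEq.identity (.act hF (.emp h) a) (.emp hF) (.act_emp k a)).symm.trans
        ((ih h).act hF a)
    refine ProvLe.antisymm (.emp (.sum hF ?_)) (.sum_le (.emp hF) ?_)
    · simp only [List.mem_map]
      rintro _ ⟨a, -, rfl⟩
      exact (key a).isExp.2
    · simp only [List.mem_map]
      rintro _ ⟨a, -, rfl⟩
      exact (key a).symm.le
  | pset F ih =>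
    simp only [NDF.toTerm, NDF.empty, Set.Finite.toFinset_empty, Finset.toList_empty,
      List.map_nil, Term.sum]
    exact .refl (.emp hF)

/-- Each clause of `Plus` is matched by axioms: distributivity over `⊕` for products, powers and
equal injections, the inconsistency identity for different injections, and the semilattice laws
alone for finite sets, where `{-}` does not distribute. -/
theorem ProvEq.toTerm_plus {Y : Type u} {v : Y → Term B A X} {G : NDF B A} {p : Y → Y → Y}
    (hv : ∀ y, IsExp G G (v y)) (hp : ∀ y z, v (p y z) = .plus (v y) (v z))
    (F : NDF B A) (hF : F.Ingredient G) (c d : F.obj Y) :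
    ProvEq G F (.plus (F.toTerm v c) (F.toTerm v d)) (F.toTerm v (F.plus p c d)) := by
  induction F with
  | id =>
    simp only [NDF.toTerm, NDF.plus, hp]
    exact .refl (((hv c).ident hF).plus ((hv d).ident hF))
  | const i =>
    have h : ∀ b : B i, IsExp G (.const i) (.const i b : Term B A X) := .const hF
    exact .identity ((h c).plus (h d)) (h _) (.const_plus i _ _)
  | sum F₁ F₂ ih₁ ih₂ =>
    have h₁ := (NDF.Step.sum_left F₁ F₂).ingredient hF
    have h₂ := (NDF.Step.sum_right F₁ F₂).ingredient hF
    have top : IsExp G (F₁.sum F₂) (.plus (.inl .emp) (.inr .emp) : Term B A X) :=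
      (IsExp.inl hF (.emp h₁)).plus (.inr hF (.emp h₂))
    have t₁ := fun c => IsExp.toTerm hv h₁ c
    have t₂ := fun c => IsExp.toTerm hv h₂ c
    have tm := fun c => IsExp.toTerm hv hF c
    have bot : ∀ c, ProvEq G (F₁.sum F₂) (.plus (NDF.toTerm v (F₁.sum F₂) c) .emp)
        (NDF.toTerm v (F₁.sum F₂) c) := fun c =>
      (ProvEq.comm (tm c) (.emp hF)).trans (.emp_plus (tm c))
    cases c with
    | bot => exact .emp_plus (tm d)
    | top =>
      cases d with
      | bot => exact bot .top
      | top => exact .idem top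
      | inl d => exact (ProvEq.comm top ((t₁ d).inl hF)).trans (.inl_plus_top hF (t₁ d))
      | inr d => exact (ProvEq.comm top ((t₂ d).inr hF)).trans (.inr_plus_top hF (t₂ d))
    | inl c =>
      cases d with
      | bot => exact bot (.inl c)
      | top => exact .inl_plus_top hF (t₁ c)
      | inl d =>
        exact (ProvEq.symm (.identity (((t₁ c).plus (t₁ d)).inl hF)
          (((t₁ c).inl hF).plus ((t₁ d).inl hF)) (.inl_plus _ _))).trans ((ih₁ h₁ c d).inl hF)
      | inr d => exact .identity (((t₁ c).inl hF).plus ((t₂ d).inr hF)) top (.inl_inr _ _)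
    | inr c =>
      cases d with
      | bot => exact bot (.inr c)
      | top => exact .inr_plus_top hF (t₂ c)
      | inl d =>
        exact (ProvEq.comm ((t₂ c).inr hF) ((t₁ d).inl hF)).trans
          (.identity (((t₁ d).inl hF).plus ((t₂ c).inr hF)) top (.inl_inr _ _))
      | inr d =>
        exact (ProvEq.symm (.identity (((t₂ c).plus (t₂ d)).inr hF)
          (((t₂ c).inr hF).plus ((t₂ d).inr hF)) (.inr_plus _ _))).trans ((ih₂ h₂ c d).inr hF)
  | prod F₁ F₂ ih₁ ih₂ =>
    have h₁ := (NDF.Step.prod_left F₁ F₂).ingredient hF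
    have h₂ := (NDF.Step.prod_right F₁ F₂).ingredient hF
    have t₁ := fun c => IsExp.toTerm hv h₁ c
    have t₂ := fun c => IsExp.toTerm hv h₂ c
    refine (ProvEq.plus_plus_plus_comm ((t₁ c.1).fst hF) ((t₂ c.2).snd hF) ((t₁ d.1).fst hF)
      ((t₂ d.2).snd hF)).trans (ProvEq.plus ?_ ?_)
    · exact (ProvEq.symm (.identity (((t₁ _).plus (t₁ _)).fst hF)
        (((t₁ _).fst hF).plus ((t₁ _).fst hF)) (.fst_plus _ _))).trans ((ih₁ h₁ _ _).fst hF)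
    · exact (ProvEq.symm (.identity (((t₂ _).plus (t₂ _)).snd hF)
        (((t₂ _).snd hF).plus ((t₂ _).snd hF)) (.snd_plus _ _))).trans ((ih₂ h₂ _ _).snd hF)
  | pow F k ih =>
    have h := (NDF.Step.pow F k).ingredient hF
    have t := fun (c : F.obj Y) (a : A k) => (IsExp.toTerm hv h c).act hF a
    have key : ∀ a, ProvEq G (.pow F k)
        (.plus (.act k a (F.toTerm v (c a))) (.act k a (F.toTerm v (d a))))
        (.act k a (F.toTerm v (F.plus p (c a) (d a)))) := fun a =>
      (ProvEq.symm (.identity (((IsExp.toTerm hv h _).plus (.toTerm hv h _)).act hF a)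
        ((t _ a).plus (t _ a)) (.act_plus _ _ _ _))).trans ((ih h _ _).act hF a)
    have mem : ∀ (c : A k → F.obj Y), ∀ e ∈ (Set.finite_univ (α := A k)).toFinset.toList.map
        (fun a => Term.act k a (F.toTerm v (c a))), IsExp G (.pow F k) e := by
      simp only [List.mem_map]
      rintro c _ ⟨a, -, rfl⟩
      exact t _ a
    have tm := fun (c : A k → F.obj Y) => IsExp.sum hF (mem c)
    -- Comparing in the order reduces the claim to single actions, where it is `key`; no induction
    -- on the enumeration of `A k` is needed.
    refine ProvLe.antisymm (.plus (.sum_mono hF (mem _) ?_) (.sum_mono hF (mem _) ?_))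
      (.sum_le ((tm c).plus (tm d)) ?_)
    · simp only [List.mem_map]
      rintro _ ⟨a, ha, rfl⟩
      exact ⟨_, ⟨a, ha, rfl⟩, (ProvLe.plus_left (t _ a) (t _ a)).trans (key a).le⟩
    · simp only [List.mem_map]
      rintro _ ⟨a, ha, rfl⟩
      exact ⟨_, ⟨a, ha, rfl⟩, (ProvLe.plus_right (t _ a) (t _ a)).trans (key a).le⟩
    · simp only [List.mem_map]
      rintro _ ⟨a, ha, rfl⟩
      exact (key a).symm.le.trans (.plus
        ((ProvLe.le_sum (mem c) (List.mem_map_of_mem ha)).trans (.plus_left (tm c) (tm d)))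
        ((ProvLe.le_sum (mem d) (List.mem_map_of_mem ha)).trans (.plus_right (tm c) (tm d))))
  | pset F ih =>
    have h := (NDF.Step.pset F).ingredient hF
    have t := fun c => (IsExp.toTerm hv h c).single hF
    have mem : ∀ (l : List (F.obj Y)), ∀ e ∈ l.map (fun c => Term.single (F.toTerm v c)),
        IsExp G (.pset F) e := by
      simp only [List.mem_map]
      rintro l _ ⟨a, -, rfl⟩
      exact t _
    have tm := fun l => IsExp.sum hF (mem l)
    refine ProvLe.antisymm (.plus (.sum_mono hF (mem _) ?_) (.sum_mono hF (mem _) ?_))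
      (.sum_le ((tm _).plus (tm _)) ?_)
    · simp only [List.mem_map, Finset.mem_toList, Set.Finite.mem_toFinset]
      rintro _ ⟨a, ha, rfl⟩
      exact ⟨_, ⟨a, .inl ha, rfl⟩, (ProvEq.refl (t a)).le⟩
    · simp only [List.mem_map, Finset.mem_toList, Set.Finite.mem_toFinset]
      rintro _ ⟨a, ha, rfl⟩
      exact ⟨_, ⟨a, .inr ha, rfl⟩, (ProvEq.refl (t a)).le⟩
    · simp only [List.mem_map, Finset.mem_toList, Set.Finite.mem_toFinset]
      rintro _ ⟨a, ha | ha, rfl⟩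
      · exact (ProvLe.le_sum (mem _) (List.mem_map_of_mem (by simpa using ha))).trans
          (.plus_left (tm _) (tm _))
      · exact (ProvLe.le_sum (mem _) (List.mem_map_of_mem (by simpa using ha))).trans
          (.plus_right (tm _) (tm _))

end Representation

/-! ### Size of functors and ingredients -/

section Ingredients

variable {ι κ : Type u} {B : ι → Type u} {A : κ → Type u}

/-- The number of constructors of a functor. -/
def NDF.size : NDF B A → ℕ
  | .id => 0
  | .const _ => 0
  | .sum F₁ F₂ => F₁.size + F₂.size + 1
  | .prod F₁ F₂ => F₁.size + F₂.size + 1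
  | .pow F _ => F.size + 1
  | .pset F => F.size + 1

theorem NDF.Step.size_lt {F F' : NDF B A} (h : NDF.Step F F') : F.size < F'.size := by
  cases h <;> simp only [NDF.size] <;> omega

theorem NDF.Ingredient.size_le {F G : NDF B A} (h : F.Ingredient G) : F.size ≤ G.size := by
  induction h with
  | refl => exact le_rfl
  | tail _ h ih => exact ih.trans h.size_lt.le

/-- Size drops strictly. So below a guarding constructor a term is read at a type other than `G`,
where a fixed point can only have type `Id` and is not unfolded; the finiteness of derivatives rests
on this. -/
theorem NDF.Step.ne_of_ingredient {F F' G : NDF B A} (h : NDF.Step F F')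
    (h' : F'.Ingredient G) : F ≠ G := by
  rintro rfl
  exact absurd h'.size_le (not_le.mpr h.size_lt)

theorem NDF.Ingredient.eq_id {F : NDF B A} (h : F.Ingredient .id) : F = .id := by
  have := h.size_le
  cases F with
  | id => rfl
  | const i =>
    rcases Relation.ReflTransGen.cases_tail h with h | ⟨_, -, h⟩
    · exact h.symm
    · cases h
  | _ => simp [NDF.size] at this

end Ingredients

/-! ### Every expression is determined by its derivative -/

section Derivatives

variable {ι κ : Type u} {B : ι → Type u} {A : κ → Type u} {X : Type u}

/-- The terms on which `deltaLayer` calls its argument `atom`. -/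
def Term.IsAtom : Term B A X → Prop
  | .emp => False
  | .var _ => False
  | .plus _ _ => False
  | .mu _ _ => False
  | _ => True

theorem Typed.not_isAtom {e : Term B A X} {F : NDF B A} (h : Typed .id e F) : ¬ e.IsAtom := by
  induction h with
  | emp | var | plus | mu => exact fun h => h
  | ident _ _ ih => exact ih
  | const i b hF => cases hF.eq_id
  | single hF => cases hF.eq_id
  | act _ hF => cases hF.eq_id
  | fst hF => cases hF.eq_id
  | snd hF => cases hF.eq_id
  | inl hF => cases hF.eq_id
  | inr hF => cases hF.eq_id

variable [DecidableEq X] [Infinite X]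

/-- Induction over the layer of sums and fixed points of a closed expression. -/
theorem IsExp.layer_induction {G F : NDF B A} {motive : ∀ e : Term B A X, IsExp G F e → Prop}
    (emp : ∀ h, motive .emp h)
    (plus : ∀ e₁ e₂ (h : IsExp G F (.plus e₁ e₂)), motive e₁ h.of_plus_left →
      motive e₂ h.of_plus_right → motive (.plus e₁ e₂) h)
    (mu : ∀ x e (h : IsExp G F (.mu x e)), motive (e.subst x (.mu x e)) h.unfold →
      motive (.mu x e) h)
    (atom : ∀ e h, e.IsAtom → motive e h) (e : Term B A X) (h : IsExp G F e) : motive e h := by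
  induction e, h using deltaLayer.induct with
  | case1 h => exact emp h
  | case2 e₁ e₂ h _ ih₁ ih₂ => exact plus e₁ e₂ h ih₁ ih₂
  | case3 x e h _ ih => exact mu x e h ih
  | case4 e h h₁ h₂ h₃ =>
    cases e with
    | emp => exact (h₁ h rfl .rfl).elim
    | plus => exact (h₂ _ _ h rfl .rfl).elim
    | mu => exact (h₃ _ _ h rfl .rfl).elim
    | var => simp [IsExp, Term.fv] at h
    | _ => exact atom _ h trivial

variable [∀ i, SemilatticeSup (B i)] [∀ i, OrderBot (B i)]

theorem delta_id {G : NDF B A} (hG : G ≠ .id) (e : Term B A X) (h : IsExp G .id e) :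
    delta G .id e h = (⟨e, h.of_ident⟩ : Exp X G G) := by
  simp only [delta, deltaId, if_neg hG]

theorem delta_emp {G F : NDF B A} (hF : F ≠ .id) (h : IsExp G F (.emp : Term B A X)) :
    delta G F .emp h = F.empty Exp.emp := by
  cases F with
  | id => exact absurd rfl hF
  | _ => rw [delta, deltaLayer]

theorem delta_plus {G F : NDF B A} (hF : F ≠ .id) {e₁ e₂ : Term B A X}
    (h : IsExp G F (.plus e₁ e₂)) :
    delta G F (.plus e₁ e₂) h =
      F.plus Exp.plus (delta G F e₁ h.of_plus_left) (delta G F e₂ h.of_plus_right) := by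
  cases F with
  | id => exact absurd rfl hF
  | _ => rw [delta, deltaLayer]

theorem delta_mu {G F : NDF B A} (hF : F ≠ .id) {x : X} {e : Term B A X}
    (h : IsExp G F (.mu x e)) :
    delta G F (.mu x e) h = delta G F (e.subst x (.mu x e)) h.unfold := by
  cases F with
  | id => exact absurd rfl hF
  | _ => rw [delta, deltaLayer]

theorem delta_const {G : NDF B A} {i : ι} {b : B i}
    (h : IsExp G (.const i) (.const i b : Term B A X)) :
    delta G (.const i) (.const i b) h = b := by
  rw [delta, deltaLayer] <;> simp

theorem delta_fst {G F₁ F₂ : NDF B A} {e : Term B A X} (h : IsExp G (.prod F₁ F₂) (.fst e)) :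
    delta G (.prod F₁ F₂) (.fst e) h = (delta G F₁ e h.of_fst, F₂.empty Exp.emp) := by
  rw [delta, deltaLayer] <;> simp

theorem delta_snd {G F₁ F₂ : NDF B A} {e : Term B A X} (h : IsExp G (.prod F₁ F₂) (.snd e)) :
    delta G (.prod F₁ F₂) (.snd e) h = (F₁.empty Exp.emp, delta G F₂ e h.of_snd) := by
  rw [delta, deltaLayer] <;> simp

theorem delta_inl {G F₁ F₂ : NDF B A} {e : Term B A X} (h : IsExp G (.sum F₁ F₂) (.inl e)) :
    delta G (.sum F₁ F₂) (.inl e) h = DPlus.inl (delta G F₁ e h.of_inl) := by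
  rw [delta, deltaLayer] <;> simp

theorem delta_inr {G F₁ F₂ : NDF B A} {e : Term B A X} (h : IsExp G (.sum F₁ F₂) (.inr e)) :
    delta G (.sum F₁ F₂) (.inr e) h = DPlus.inr (delta G F₂ e h.of_inr) := by
  rw [delta, deltaLayer] <;> simp

open Classical in
theorem delta_act {G F : NDF B A} {k : κ} {a : A k} {e : Term B A X}
    (h : IsExp G (.pow F k) (.act k a e)) :
    delta G (.pow F k) (.act k a e) h =
      fun a' => if a = a' then delta G F e h.of_act else F.empty Exp.emp := by
  rw [delta, deltaLayer] <;> simp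

theorem delta_single {G F : NDF B A} {e : Term B A X} (h : IsExp G (.pset F) (.single e)) :
    delta G (.pset F) (.single e) h = ⟨{delta G F e h.of_single}, Set.finite_singleton _⟩ := by
  rw [delta, deltaLayer] <;> simp

theorem ProvEq.mu {G F : NDF B A} {x : X} {e : Term B A X} (h : IsExp G F (.mu x e)) :
    ProvEq G F (.mu x e) (e.subst x (.mu x e)) :=
  .symm (.identity h.unfold h (.fp x e))

/-- Over the functor `Id` all closed expressions are provably empty. -/
theorem ProvEq.eq_emp {e : Term B A X} (h : IsExp (.id : NDF B A) .id e) :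
    ProvEq .id .id e .emp := by
  have hI : NDF.Ingredient (.id : NDF B A) .id := Relation.ReflTransGen.refl
  induction e, h using IsExp.layer_induction with
  | emp h => exact .refl h
  | plus e₁ e₂ h ih₁ ih₂ => exact (ih₁.plus ih₂).trans (.idem (.emp hI))
  | mu x e h ih => exact (ProvEq.mu h).trans ih
  | atom e h ha => exact absurd ha h.2.2.not_isAtom

variable [∀ k, Finite (A k)]

/-- `δ` commutes with `∅` and `⊕` and is invariant under unfolding, and the description does the
same up to `≡`, so only the guarding constructors and constants depend on `F`. -/
theorem ProvEq.toTerm_delta_of_atom {G F : NDF B A} (hF : F ≠ .id)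
    (atom : ∀ (e : Term B A X) (h : IsExp G F e), e.IsAtom →
      ProvEq G F e (F.toTerm Subtype.val (delta G F e h)))
    (e : Term B A X) (h : IsExp G F e) :
    ProvEq G F e (F.toTerm Subtype.val (delta G F e h)) := by
  induction e, h using IsExp.layer_induction with
  | emp h =>
    rw [delta_emp hF]
    exact .toTerm_empty rfl F h.ingredient
  | plus e₁ e₂ h ih₁ ih₂ =>
    rw [delta_plus hF]
    exact (ih₁.plus ih₂).trans
      (.toTerm_plus (fun y => y.2) (fun _ _ => rfl) F h.ingredient _ _)
  | mu x e h ih =>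
    rw [delta_mu hF]
    exact (ProvEq.mu h).trans ih
  | atom e h ha => exact atom e h ha

/-- A fundamental theorem in the style of Kleene algebra. At type `Id` the derivative of `e` is `e`
itself, which is where `G ≠ Id` enters; at other types the outermost constructor is matched and the
induction continues with a smaller functor. -/
theorem ProvEq.toTerm_delta {G : NDF B A} (hG : G ≠ .id) (F : NDF B A)
    (e : Term B A X) (h : IsExp G F e) :
    ProvEq G F e (F.toTerm Subtype.val (delta G F e h)) := by
  induction F generalizing e with
  | id =>
    rw [delta_id hG]
    exact .refl h
  | const i =>
    refine toTerm_delta_of_atom (by simp) (fun e h ha => ?_) e h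
    have ht := h.2.2
    cases ht with
    | emp | plus | mu | var => exact ha.elim
    | const i b hF =>
      rw [delta_const]
      exact .refl (.const hF b)
  | sum F₁ F₂ ih₁ ih₂ =>
    refine toTerm_delta_of_atom (by simp) (fun e h ha => ?_) e h
    have hF := h.ingredient
    have ht := h.2.2
    cases ht with
    | emp | plus | mu | var => exact ha.elim
    | inl hF ht =>
      rw [delta_inl]
      exact (ih₁ _ h.of_inl).inl hF
    | inr hF ht =>
      rw [delta_inr]
      exact (ih₂ _ h.of_inr).inr hF
  | prod F₁ F₂ ih₁ ih₂ =>
    refine toTerm_delta_of_atom (by simp) (fun e h ha => ?_) e h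
    have hF := h.ingredient
    have h₁ := (NDF.Step.prod_left F₁ F₂).ingredient hF
    have h₂ := (NDF.Step.prod_right F₁ F₂).ingredient hF
    have ht := h.2.2
    cases ht with
    | emp | plus | mu | var => exact ha.elim
    | @fst e _ _ hF ht =>
      rw [delta_fst]
      have e₂ : ProvEq G (.prod F₁ F₂) (.snd .emp) .emp :=
        .identity (.snd hF (.emp h₂)) (.emp hF) (.snd_emp (X := X))
      -- The missing second component is created from nothing: `l⟨e⟩ ≡ l⟨e⟩ ⊕ ∅ ≡ l⟨e⟩ ⊕ r⟨∅⟩`.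
      refine (ProvEq.emp_plus h).symm.trans ((ProvEq.comm (.emp hF) h).trans ?_)
      exact ((ih₁ _ h.of_fst).fst hF).plus
        (e₂.symm.trans ((ProvEq.toTerm_empty rfl F₂ h₂).snd hF))
    | @snd e _ _ hF ht =>
      rw [delta_snd]
      have e₁ : ProvEq G (.prod F₁ F₂) (.fst .emp) .emp :=
        .identity (.fst hF (.emp h₁)) (.emp hF) (.fst_emp (X := X))
      refine (ProvEq.emp_plus h).symm.trans ?_
      exact (e₁.symm.trans ((ProvEq.toTerm_empty rfl F₁ h₁).fst hF)).plus
        ((ih₂ _ h.of_snd).snd hF)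
  | pow F k ih =>
    refine toTerm_delta_of_atom (by simp) (fun e h ha => ?_) e h
    have hF := h.ingredient
    have h₁ := (NDF.Step.pow F k).ingredient hF
    have ht := h.2.2
    cases ht with
    | emp | plus | mu | var => exact ha.elim
    | @act _ a e _ hF ht =>
      have mem : ∀ (c : A k → F.obj (Exp X G G)), ∀ e ∈
          (Set.finite_univ (α := A k)).toFinset.toList.map
            (fun a => Term.act k a (F.toTerm Subtype.val (c a))), IsExp G (.pow F k) e := by
        simp only [List.mem_map]
        rintro c _ ⟨a, -, rfl⟩
        exact (IsExp.toTerm (fun y => y.2) h₁ _).act hF a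
      rw [delta_act]
      refine ProvLe.antisymm ?_ (ProvLe.sum_le h ?_)
      · refine ((ih _ h.of_act).act hF a).le.trans (.le_sum (mem _) ?_)
        exact List.mem_map.mpr ⟨a, by simp, by simp⟩
      · simp only [List.mem_map]
        rintro _ ⟨a', -, rfl⟩
        split
        · rename_i haa
          subst haa
          exact ((ih _ h.of_act).act hF a).symm.le
        -- For an action other than `a` the summand is provably `a'(∅) ≡ ∅`, hence below everything.
        · exact ((ProvEq.toTerm_empty rfl F h₁).act hF a').symm.le.trans
            ((ProvEq.identity (.act hF (.emp h₁) a') (.emp hF) (.act_emp k a')).le.trans (.emp h))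
  | pset F ih =>
    refine toTerm_delta_of_atom (by simp) (fun e h ha => ?_) e h
    have hF := h.ingredient
    have ht := h.2.2
    cases ht with
    | emp | plus | mu | var => exact ha.elim
    | single hF ht =>
      rw [delta_single]
      have key := (ih _ h.of_single).single hF
      simp only [NDF.toTerm, Set.Finite.toFinset_singleton, Finset.toList_singleton,
        List.map_cons, List.map_nil, Term.sum]
      -- A one-element sum still ends in `⊕ ∅`.
      exact key.trans ((ProvEq.emp_plus key.isExp.2).symm.trans
        (.comm (.emp hF) key.isExp.2))

end Derivatives

/-! ### Unique solutions of guarded systems -/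

section Systems

variable {ι κ : Type u} {B : ι → Type u} {A : κ → Type u} {X : Type u}
  [DecidableEq X] [Infinite X] [∀ i, SemilatticeSup (B i)] [∀ i, OrderBot (B i)]
  [∀ k, Finite (A k)]

/-- Eliminating the unknowns `W` from a guarded system of equations `x p = u p`: for `i ∈ W` there
is an expression in the other unknowns to which the `i`-th component of every solution is provably
equal. -/
theorem exists_partial_solution {G : NDF B A} (hG : G ≠ .id) {P : Type u} [DecidableEq P]
    (x : P → X) (u : P → G.obj P) (W : Finset P) :
    ∀ i ∈ W, ∃ e : Term B A X, e.IsExpr ∧ Typed G e G ∧ (∀ z ∈ e.fv, ∃ j ∉ W, z = x j) ∧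
      ∀ (s : P → Term B A X) (σ : X → Term B A X), (∀ z, IsExp G G (σ z)) →
        (∀ j, σ (x j) = s j) → (∀ j ∈ W, ProvEq G G (s j) (G.toTerm s (u j))) →
        ProvEq G G (s i) (e.bind σ) := by
  have hGG : G.Ingredient G := Relation.ReflTransGen.refl
  induction W using Finset.strongInduction with
  | H W ih =>
    intro i hi
    have : Nonempty (Term B A X) := ⟨.emp⟩
    -- Gaussian elimination: the other unknowns of `W` are expressed first, possibly in terms of `x
    -- i`. Inserting these expressions into equation `i` and binding `x i` by `μ` leaves only
    -- unknowns outside `W`.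
    have ih := ih (W.erase i) (Finset.erase_ssubset hi)
    choose! a haE haT haF ha using ih
    let v : P → Term B A X := fun j => if j ∈ W.erase i then a j else .var (x j)
    have hvE : ∀ j, (v j).IsExpr := by
      intro j
      by_cases hj : j ∈ W.erase i
      · simpa only [v, if_pos hj] using haE j hj
      · simp only [v, if_neg hj]; trivial
    have hvT : ∀ j, Typed G (v j) G := by
      intro j
      by_cases hj : j ∈ W.erase i
      · simpa only [v, if_pos hj] using haT j hj
      · simp only [v, if_neg hj]; exact .var _
    have hvF : ∀ j, ∀ z ∈ (v j).fv, ∃ k ∉ W.erase i, z = x k := by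
      intro j
      by_cases hj : j ∈ W.erase i
      · simpa only [v, if_pos hj] using haF j hj
      · simp only [v, if_neg hj, Term.fv, Finset.mem_singleton]
        rintro z rfl
        exact ⟨j, hj, rfl⟩
    have hT : Typed G (.mu (x i) (G.toTerm v (u i))) G := .mu _ (.toTerm hvT G hGG _)
    have hE : (Term.mu (x i) (G.toTerm v (u i))).IsExpr :=
      ⟨NDF.isGuarded_toTerm hG _, G.isExpr_toTerm hvE _⟩
    refine ⟨.mu (x i) (G.toTerm v (u i)), hE, hT, ?_, ?_⟩
    · intro z hz
      simp only [Term.fv, Finset.mem_erase] at hz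
      obtain ⟨j, hj⟩ := G.mem_fv_toTerm _ hz.2
      obtain ⟨k, hk, rfl⟩ := hvF j z hj
      refine ⟨k, fun hkW => hk (Finset.mem_erase.mpr ⟨?_, hkW⟩), rfl⟩
      rintro rfl
      exact hz.1 rfl
    · intro s σ hσ hσs hs
      have safe : SafeSubst σ := fun z => .inr (hσ z).1
      have hexp : IsExp G G ((Term.mu (x i) (G.toTerm v (u i))).bind σ) := by
        refine ⟨Finset.eq_empty_of_forall_notMem fun z hz => ?_,
          hE.bind σ fun z => (hσ z).2.1, hT.bind σ fun z => (hσ z).2.2⟩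
        obtain ⟨w, -, hw⟩ := Term.mem_fv_bind _ _ hz
        simp [(hσ w).1] at hw
      rw [safe.bind_mu] at hexp ⊢
      -- By (Unique) it suffices that `s i` is a fixed point of the instantiated body.
      refine .symm (.unique hexp ?_)
      have hsi : (s i).fv = ∅ := by rw [← hσs]; exact (hσ _).1
      -- As `σ (x i) = s i`, putting `s i` for `x i` in the instantiated body amounts to applying
      -- `σ` to the original one. What remains is equation `i` with each `s j`, for `j` in `W.erase
      -- i`, replaced by its provably equal expression.
      rw [safe.subst_bind _ _ hsi, ← hσs, Function.update_eq_self, NDF.toTerm_bind]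
      rw [hσs]
      refine .trans (.toTerm_congr (fun j => .symm ?_) G hGG _) (hs i hi).symm
      by_cases hj : j ∈ W.erase i
      · simp only [v, if_pos hj]
        exact ha j hj s σ hσ hσs fun k hk => hs k (Finset.mem_of_mem_erase hk)
      · simp only [v, if_neg hj, Term.bind, hσs]
        refine .refl ?_
        rw [← hσs]
        exact hσ _

/-- Guarded finite systems of equations have provably unique solutions. -/
theorem ProvEq.of_system {G : NDF B A} (hG : G ≠ .id) {P : Type u} [Finite P]
    (u : P → G.obj P) {s t : P → Term B A X} (hs : ∀ p, ProvEq G G (s p) (G.toTerm s (u p)))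
    (ht : ∀ p, ProvEq G G (t p) (G.toTerm t (u p))) (p : P) : ProvEq G G (s p) (t p) := by
  classical
  have := Fintype.ofFinite P
  -- Distinct variables for distinct unknowns, so that every solution arises from a substitution.
  let x : P → X := fun p => Infinite.natEmbedding X (Fintype.equivFin P p)
  have hx : Function.Injective x := fun p q h => by simpa [x, Fin.val_inj] using h
  obtain ⟨e, -, -, he, key⟩ := exists_partial_solution hG x u Finset.univ p (Finset.mem_univ p)
  have hc : e.fv = ∅ := Finset.eq_empty_of_forall_notMem fun z hz => by
    obtain ⟨j, hj, -⟩ := he z hz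
    exact hj (Finset.mem_univ j)
  have aux : ∀ s : P → Term B A X, (∀ p, ProvEq G G (s p) (G.toTerm s (u p))) →
      ProvEq G G (s p) e := by
    intro s hs
    -- The value `∅` at variables that are not unknowns only serves to make the substitution closed.
    -- As `e` itself is closed, the same `e` is obtained for every solution.
    have := key s (Function.extend x s fun _ => .emp) (fun z => ?_)
      (fun j => hx.extend_apply _ _ _) fun j _ => hs j
    · rwa [Term.bind_of_closed hc] at this
    · by_cases hz : ∃ j, x j = z
      · obtain ⟨j, rfl⟩ := hz
        rw [hx.extend_apply]
        exact (hs j).isExp.1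
      · rw [Function.extend_apply' _ _ _ hz]
        exact .emp Relation.ReflTransGen.refl
  exact (aux s hs).trans (aux t ht).symm

end Systems

/-! ### Predicate lifting along functors -/

section Liftings

variable {ι κ : Type u} {B : ι → Type u} {A : κ → Type u}

/-- All elements of `Y` occurring in an element of `F(Y)` satisfy `p`. -/
def NDF.All {Y : Type u} (p : Y → Prop) : (F : NDF B A) → F.obj Y → Prop
  | .id, y => p y
  | .const _, _ => True
  | .sum _ _, .bot => True
  | .sum _ _, .top => True
  | .sum F₁ _, .inl c => F₁.All p c
  | .sum _ F₂, .inr c => F₂.All p c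
  | .prod F₁ F₂, c => F₁.All p c.1 ∧ F₂.All p c.2
  | .pow F _, c => ∀ a, F.All p (c a)
  | .pset F, s => ∀ c ∈ s.1, F.All p c

theorem NDF.All.of_map {Y Z : Type u} {f : Y → Z} {p : Z → Prop} (F : NDF B A)
    {c : F.obj Y} (hc : F.All p (F.map f c)) : F.All (fun y => p (f y)) c := by
  induction F with
  | id => exact hc
  | const => trivial
  | sum F₁ F₂ ih₁ ih₂ =>
    cases c with
    | bot => trivial
    | top => trivial
    | inl c => exact ih₁ hc
    | inr c => exact ih₂ hc
  | prod F₁ F₂ ih₁ ih₂ => exact ⟨ih₁ hc.1, ih₂ hc.2⟩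
  | pow F k ih => exact fun a => ih (hc a)
  | pset F ih => exact fun d hd => ih (hc _ ⟨d, hd, rfl⟩)

theorem NDF.All.and {Y : Type u} {p q : Y → Prop} (F : NDF B A)
    {c : F.obj Y} (hp : F.All p c) (hq : F.All q c) : F.All (fun y => p y ∧ q y) c := by
  induction F with
  | id => exact ⟨hp, hq⟩
  | const => trivial
  | sum F₁ F₂ ih₁ ih₂ =>
    cases c with
    | bot => trivial
    | top => trivial
    | inl c => exact ih₁ hp hq
    | inr c => exact ih₂ hp hq
  | prod F₁ F₂ ih₁ ih₂ => exact ⟨ih₁ hp.1 hq.1, ih₂ hp.2 hq.2⟩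
  | pow F k ih => exact fun a => ih (hp a) (hq a)
  | pset F ih => exact fun d hd => ih (hp d hd) (hq d hd)

/-- An element of `F(Y)` all of whose entries satisfy `p` comes from `F({y // p y})`. -/
theorem NDF.All.exists_map_val {Y : Type u} {p : Y → Prop} (F : NDF B A)
    {c : F.obj Y} (hc : F.All p c) :
    ∃ d : F.obj {y // p y}, F.map Subtype.val d = c := by
  induction F with
  | id => exact ⟨⟨c, hc⟩, rfl⟩
  | const => exact ⟨c, rfl⟩
  | sum F₁ F₂ ih₁ ih₂ =>
    cases c with
    | bot => exact ⟨.bot, rfl⟩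
    | top => exact ⟨.top, rfl⟩
    | inl c => obtain ⟨d, rfl⟩ := ih₁ hc; exact ⟨.inl d, rfl⟩
    | inr c => obtain ⟨d, rfl⟩ := ih₂ hc; exact ⟨.inr d, rfl⟩
  | prod F₁ F₂ ih₁ ih₂ =>
    obtain ⟨d₁, h₁⟩ := ih₁ hc.1
    obtain ⟨d₂, h₂⟩ := ih₂ hc.2
    exact ⟨(d₁, d₂), Prod.ext h₁ h₂⟩
  | pow F k ih =>
    choose d hd using fun a => ih (hc a)
    exact ⟨d, funext hd⟩
  | pset F ih =>
    have := c.2.to_subtype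
    choose d hd using fun c' : c.1 => ih (hc c'.1 c'.2)
    refine ⟨⟨Set.range d, Set.finite_range d⟩, Subtype.ext ?_⟩
    simp only [NDF.map]
    rw [← Set.range_comp]
    exact (congrArg Set.range (funext hd)).trans Subtype.range_coe

theorem NDF.map_map {Y Z V : Type u} (f : Y → Z) (g : Z → V) (F : NDF B A) (c : F.obj Y) :
    F.map g (F.map f c) = F.map (fun y => g (f y)) c := by
  induction F with
  | id => rfl
  | const => rfl
  | sum F₁ F₂ ih₁ ih₂ =>
    cases c with
    | bot => rfl
    | top => rfl
    | inl c => exact congrArg DPlus.inl (ih₁ c)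
    | inr c => exact congrArg DPlus.inr (ih₂ c)
  | prod F₁ F₂ ih₁ ih₂ => exact Prod.ext (ih₁ _) (ih₂ _)
  | pow F k ih => exact funext fun a => ih _
  | pset F ih =>
    refine Subtype.ext ?_
    simp only [NDF.map, Set.image_image, ih]

end Liftings

/-! ### Finitely many derivatives up to sums -/

section Closure

variable {ι κ : Type u} {B : ι → Type u} {A : κ → Type u} {X : Type u}

/-- The terms obtained from those in `U` and the empty term by sums. -/
inductive SumTree (U : Set (Term B A X)) : Term B A X → Prop
  | emp : SumTree U .emp
  | of {e} : e ∈ U → SumTree U e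
  | plus {e₁ e₂} : SumTree U e₁ → SumTree U e₂ → SumTree U (.plus e₁ e₂)

variable [∀ i, SemilatticeSup (B i)]

theorem NDF.All.plus {Y : Type u} {p : Y → Prop} {op : Y → Y → Y}
    (h : ∀ y z, p y → p z → p (op y z)) (F : NDF B A) {c d : F.obj Y} (hc : F.All p c)
    (hd : F.All p d) : F.All p (F.plus op c d) := by
  induction F with
  | id => exact h c d hc hd
  | const => trivial
  | sum F₁ F₂ ih₁ ih₂ =>
    cases c with
    | bot => exact hd
    | top => cases d <;> trivial
    | inl c =>
      cases d with
      | bot => exact hc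
      | inl d => exact ih₁ hc hd
      | _ => trivial
    | inr c =>
      cases d with
      | bot => exact hc
      | inr d => exact ih₂ hc hd
      | _ => trivial
  | prod F₁ F₂ ih₁ ih₂ => exact ⟨ih₁ hc.1 hd.1, ih₂ hc.2 hd.2⟩
  | pow F k ih => exact fun a => ih (hc a) (hd a)
  | pset F ih => exact fun e he => he.elim (hc e) (hd e)

variable [DecidableEq X]

theorem SumTree.all_plus {G : NDF B A} {U : Set (Term B A X)} (F : NDF B A)
    {c d : F.obj (Exp X G G)} (hc : F.All (fun d => SumTree U d.1) c)
    (hd : F.All (fun d => SumTree U d.1) d) :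
    F.All (fun d => SumTree U d.1) (F.plus Exp.plus c d) :=
  .plus (p := fun d : Exp X G G => SumTree U d.1) (fun _ _ h h' => SumTree.plus h h') F hc hd

variable [∀ i, OrderBot (B i)]

theorem NDF.All.empty {Y : Type u} {p : Y → Prop} {z : Y} (hz : p z) (F : NDF B A) :
    F.All p (F.empty z) := by
  induction F with
  | id => exact hz
  | const | sum => trivial
  | prod F₁ F₂ ih₁ ih₂ => exact ⟨ih₁, ih₂⟩
  | pow F k ih => exact fun _ => ih
  | pset F ih => exact fun _ h => h.elim

theorem SumTree.all_empty {G : NDF B A} (U : Set (Term B A X)) (F : NDF B A) :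
    F.All (fun d : Exp X G G => SumTree U d.1) (F.empty Exp.emp) :=
  .empty (p := fun d : Exp X G G => SumTree U d.1) SumTree.emp F

variable [Infinite X]

/-- The derivatives of `e` at type `F` are sums of elements of `U`. -/
def DerivIn (G : NDF B A) (U : Set (Term B A X)) (F : NDF B A) (e : Term B A X) : Prop :=
  ∀ h : IsExp G F e, F.All (fun d => SumTree U d.1) (delta G F e h)

theorem DerivIn.id {G : NDF B A} (hG : G ≠ .id) {U : Set (Term B A X)} {e : Term B A X}
    (he : SumTree U e) : DerivIn G U .id e := fun h => by
  rw [delta_id hG]; exact he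

theorem DerivIn.emp {G : NDF B A} (hG : G ≠ .id) {U : Set (Term B A X)} (F : NDF B A) :
    DerivIn G U F .emp := fun h => by
  by_cases hF : F = .id
  · subst hF; exact DerivIn.id hG .emp h
  · rw [delta_emp hF]; exact SumTree.all_empty U F

theorem DerivIn.plus {G : NDF B A} (hG : G ≠ .id) {U : Set (Term B A X)} {F : NDF B A}
    {e₁ e₂ : Term B A X} (he : .plus e₁ e₂ ∈ U) (h₁ : DerivIn G U F e₁)
    (h₂ : DerivIn G U F e₂) : DerivIn G U F (.plus e₁ e₂) := fun h => by
  by_cases hF : F = .id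
  · subst hF; exact DerivIn.id hG (.of he) h
  · rw [delta_plus hF]
    exact SumTree.all_plus F (h₁ _) (h₂ _)

/-- A fixed point has type `G` or `Id` only. At `Id` it is its own derivative, so membership in `U`
suffices and the unfolding matters at `G` alone. -/
theorem DerivIn.mu {G : NDF B A} (hG : G ≠ .id) {U : Set (Term B A X)} {F : NDF B A}
    {x : X} {e : Term B A X} (he : .mu x e ∈ U)
    (h' : F = G → DerivIn G U F (e.subst x (.mu x e))) : DerivIn G U F (.mu x e) := fun h => by
  rcases h.2.2.of_mu.2 with hF | hF
  · rw [delta_mu (hF ▸ hG)]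
    exact h' hF _
  · subst hF; exact DerivIn.id hG (.of he) h

theorem DerivIn.const {G : NDF B A} (hG : G ≠ .id) {U : Set (Term B A X)} {F : NDF B A}
    {i : ι} {b : B i} (he : .const i b ∈ U) : DerivIn G U F (.const i b) := fun h => by
  have ht := h.2.2
  cases ht with
  | const => trivial
  | ident => exact DerivIn.id hG (.of he) h

/-- The argument is differentiated at a proper ingredient of `G`, so nothing is asked of it at type
`G`. The lemmas for the other guarding constructors follow the same pattern. -/
theorem DerivIn.fst {G : NDF B A} (hG : G ≠ .id) {U : Set (Term B A X)} {F : NDF B A}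
    {e : Term B A X} (he : .fst e ∈ U) (h' : ∀ F' ≠ G, DerivIn G U F' e) :
    DerivIn G U F (.fst e) := fun h => by
  have ht := h.2.2
  cases ht with
  | ident => exact DerivIn.id hG (.of he) h
  | fst hF =>
    rw [delta_fst]
    exact ⟨h' _ ((NDF.Step.prod_left _ _).ne_of_ingredient hF) _, SumTree.all_empty U _⟩

theorem DerivIn.snd {G : NDF B A} (hG : G ≠ .id) {U : Set (Term B A X)} {F : NDF B A}
    {e : Term B A X} (he : .snd e ∈ U) (h' : ∀ F' ≠ G, DerivIn G U F' e) :
    DerivIn G U F (.snd e) := fun h => by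
  have ht := h.2.2
  cases ht with
  | ident => exact DerivIn.id hG (.of he) h
  | snd hF =>
    rw [delta_snd]
    exact ⟨SumTree.all_empty U _, h' _ ((NDF.Step.prod_right _ _).ne_of_ingredient hF) _⟩

theorem DerivIn.inl {G : NDF B A} (hG : G ≠ .id) {U : Set (Term B A X)} {F : NDF B A}
    {e : Term B A X} (he : .inl e ∈ U) (h' : ∀ F' ≠ G, DerivIn G U F' e) :
    DerivIn G U F (.inl e) := fun h => by
  have ht := h.2.2
  cases ht with
  | ident => exact DerivIn.id hG (.of he) h
  | inl hF =>
    rw [delta_inl]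
    exact h' _ ((NDF.Step.sum_left _ _).ne_of_ingredient hF) _

theorem DerivIn.inr {G : NDF B A} (hG : G ≠ .id) {U : Set (Term B A X)} {F : NDF B A}
    {e : Term B A X} (he : .inr e ∈ U) (h' : ∀ F' ≠ G, DerivIn G U F' e) :
    DerivIn G U F (.inr e) := fun h => by
  have ht := h.2.2
  cases ht with
  | ident => exact DerivIn.id hG (.of he) h
  | inr hF =>
    rw [delta_inr]
    exact h' _ ((NDF.Step.sum_right _ _).ne_of_ingredient hF) _

theorem DerivIn.act {G : NDF B A} (hG : G ≠ .id) {U : Set (Term B A X)} {F : NDF B A}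
    {k : κ} {a : A k} {e : Term B A X} (he : .act k a e ∈ U)
    (h' : ∀ F' ≠ G, DerivIn G U F' e) : DerivIn G U F (.act k a e) := fun h => by
  have ht := h.2.2
  cases ht with
  | ident => exact DerivIn.id hG (.of he) h
  | act _ hF =>
    rw [delta_act]
    intro a'
    dsimp only
    split
    · exact h' _ ((NDF.Step.pow _ _).ne_of_ingredient hF) _
    · exact SumTree.all_empty U _

theorem DerivIn.single {G : NDF B A} (hG : G ≠ .id) {U : Set (Term B A X)} {F : NDF B A}
    {e : Term B A X} (he : .single e ∈ U) (h' : ∀ F' ≠ G, DerivIn G U F' e) :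
    DerivIn G U F (.single e) := fun h => by
  have ht := h.2.2
  cases ht with
  | ident => exact DerivIn.id hG (.of he) h
  | single hF =>
    rw [delta_single]
    rintro c rfl
    exact h' _ ((NDF.Step.pset _).ne_of_ingredient hF) _

/-- `S` is a finite set of terms which contains `e[σ]` and whose elements have all their
derivatives in the span of `S` and of the values of `σ`, provided the latter do. -/
structure IsClosure (G : NDF B A) (e : Term B A X) (σ : X → Term B A X)
    (S : Set (Term B A X)) : Prop where
  finite : S.Finite
  mem : e.bind σ ∈ S ∪ σ '' e.fv
  -- Nothing is assumed here about the derivatives of the values of `σ`; this breaks the circularity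
  -- at fixed points, whose variable is replaced by the fixed point itself. Quantifying over all
  -- larger `U` lets closures of subterms be combined.
  derivIn : ∀ U, S ∪ σ '' e.fv ⊆ U → ∀ F, e.IsGuarded ∨ F ≠ G → DerivIn G U F (e.bind σ)
  closed : ∀ U, S ∪ σ '' e.fv ⊆ U → (∀ w ∈ e.fv, ∀ F, DerivIn G U F (σ w)) →
    ∀ s ∈ S, ∀ F, DerivIn G U F s

theorem IsClosure.derivIn_bind {G : NDF B A} {e : Term B A X} {σ : X → Term B A X}
    {S U : Set (Term B A X)} (h : IsClosure G e σ S) (hU : S ∪ σ '' e.fv ⊆ U)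
    (hσ : ∀ w ∈ e.fv, ∀ F, DerivIn G U F (σ w)) (F : NDF B A) :
    DerivIn G U F (e.bind σ) := by
  rcases h.mem with hm | ⟨w, hw, he⟩
  · exact h.closed U hU hσ _ hm F
  · rw [← he]; exact hσ w hw F

/-- A closure of `C e`, where `C` is a guarding constructor, is obtained from one of `e`. -/
theorem IsClosure.guarded {G : NDF B A} {e : Term B A X} {σ : X → Term B A X}
    {S : Set (Term B A X)} (C : Term B A X → Term B A X)
    (hfv : (C e).fv = e.fv) (hbind : (C e).bind σ = C (e.bind σ))
    (hC : ∀ (U : Set (Term B A X)) F, C (e.bind σ) ∈ U →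
      (∀ F' ≠ G, DerivIn G U F' (e.bind σ)) → DerivIn G U F (C (e.bind σ)))
    (h : IsClosure G e σ S) : IsClosure G (C e) σ (insert (C (e.bind σ)) S) := by
  have key : ∀ U, insert (C (e.bind σ)) S ∪ σ '' e.fv ⊆ U → ∀ F,
      DerivIn G U F (C (e.bind σ)) := fun U hU F =>
    hC U F (hU (.inl (.inl rfl))) fun F' hF' =>
      h.derivIn U (fun d hd => hU (hd.imp_left .inr)) F' (.inr hF')
  refine ⟨h.finite.insert _, ?_, ?_, ?_⟩
  · rw [hbind]; exact .inl (.inl rfl)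
  · rw [hfv, hbind]; exact fun U hU F _ => key U hU F
  · rw [hfv]
    rintro U hU hσ s (rfl | hs) F
    · exact key U hU F
    · exact h.closed U (fun d hd => hU (hd.imp_left .inr)) hσ s hs F

/-- Expressions have only finitely many derivatives up to sums. -/
theorem exists_isClosure {G : NDF B A} (hG : G ≠ .id) {e : Term B A X} (he : e.IsExpr) :
    ∀ σ : X → Term B A X, SafeSubst σ → (∀ w ∈ e.fv, ∃ y d, σ w = .mu y d) →
      (∀ w ∈ e.fv, (σ w).fv = ∅) → ∃ S, IsClosure G e σ S := by
  induction e with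
  | emp =>
    intro σ _ _ _
    refine ⟨{.emp}, Set.finite_singleton _, .inl rfl, fun U _ F _ => .emp hG F, ?_⟩
    rintro U - - s rfl F
    exact .emp hG F
  | const i b =>
    intro σ _ _ _
    refine ⟨{.const i b}, Set.finite_singleton _, .inl rfl,
      fun U hU F _ => .const hG (hU (.inl rfl)), ?_⟩
    rintro U hU - s rfl F
    exact .const hG (hU (.inl rfl))
  | var x =>
    intro σ _ hσ _
    have hx : x ∈ (Term.var x : Term B A X).fv := by simp [Term.fv]
    refine ⟨∅, Set.finite_empty, .inr ⟨x, hx, rfl⟩, fun U hU F hF => ?_, by simp⟩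
    have hU : σ x ∈ U := hU (.inr ⟨x, hx, rfl⟩)
    obtain ⟨y, d, hd⟩ := hσ x hx
    simp only [Term.bind]
    rw [hd] at hU ⊢
    -- A variable is not guarded, so `F ≠ G` and the fixed point put in its place is never unfolded
    -- here.
    exact .mu hG hU fun h => (hF.elim (fun h => h) (fun h' => h' h)).elim
  | plus e₁ e₂ ih₁ ih₂ =>
    intro σ safe hσ hσ'
    simp only [Term.fv, Finset.mem_union] at hσ hσ'
    obtain ⟨S₁, h₁⟩ := ih₁ he.1 σ safe (fun w hw => hσ w (.inl hw)) (fun w hw => hσ' w (.inl hw))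
    obtain ⟨S₂, h₂⟩ := ih₂ he.2 σ safe (fun w hw => hσ w (.inr hw)) (fun w hw => hσ' w (.inr hw))
    have sub₁ : ∀ {U : Set (Term B A X)},
        insert ((Term.plus e₁ e₂).bind σ) (S₁ ∪ S₂) ∪ σ '' (Term.plus e₁ e₂).fv ⊆ U →
        S₁ ∪ σ '' e₁.fv ⊆ U := by
      rintro U hU d (hd | ⟨w, hw, rfl⟩)
      · exact hU (.inl (.inr (.inl hd)))
      · exact hU (.inr ⟨w, Finset.mem_union_left _ hw, rfl⟩)
    have sub₂ : ∀ {U : Set (Term B A X)},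
        insert ((Term.plus e₁ e₂).bind σ) (S₁ ∪ S₂) ∪ σ '' (Term.plus e₁ e₂).fv ⊆ U →
        S₂ ∪ σ '' e₂.fv ⊆ U := by
      rintro U hU d (hd | ⟨w, hw, rfl⟩)
      · exact hU (.inl (.inr (.inr hd)))
      · exact hU (.inr ⟨w, Finset.mem_union_right _ hw, rfl⟩)
    refine ⟨insert ((Term.plus e₁ e₂).bind σ) (S₁ ∪ S₂), (h₁.finite.union h₂.finite).insert _,
      .inl (.inl rfl), fun U hU F hF => ?_, ?_⟩
    · exact .plus hG (hU (.inl (.inl rfl)))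
        (h₁.derivIn U (sub₁ hU) F (hF.imp_left And.left))
        (h₂.derivIn U (sub₂ hU) F (hF.imp_left And.right))
    · intro U hU hd
      have hd₁ : ∀ w ∈ e₁.fv, ∀ F, DerivIn G U F (σ w) :=
        fun w hw => hd w (Finset.mem_union_left _ hw)
      have hd₂ : ∀ w ∈ e₂.fv, ∀ F, DerivIn G U F (σ w) :=
        fun w hw => hd w (Finset.mem_union_right _ hw)
      rintro s (rfl | hs | hs) F
      · exact .plus hG (hU (.inl (.inl rfl))) (h₁.derivIn_bind (sub₁ hU) hd₁ F)
          (h₂.derivIn_bind (sub₂ hU) hd₂ F)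
      · exact h₁.closed U (sub₁ hU) hd₁ s hs F
      · exact h₂.closed U (sub₂ hU) hd₂ s hs F
  | mu x e ih =>
    intro σ safe hσ hσ'
    set d := (Term.mu x e).bind σ with hd
    have hdfv : d.fv = ∅ := Finset.eq_empty_of_forall_notMem fun z hz => by
      obtain ⟨w, hw, hz⟩ := Term.mem_fv_bind _ _ hz
      simp [hσ' w hw] at hz
    have hmu : d = .mu x (e.bind (Function.update σ x (.var x))) := safe.bind_mu x e
    have hfv : ∀ w ∈ e.fv, w ≠ x → w ∈ (Term.mu x e).fv := fun w hw hx => by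
      simp [Term.fv, hw, hx]
    obtain ⟨S, h⟩ := ih he.2 (Function.update σ x d) (safe.update x (.inr hdfv))
      (fun w hw => by
        by_cases hx : w = x
        · subst hx; exact ⟨_, _, by rw [Function.update_self]; exact hmu⟩
        · rw [Function.update_of_ne hx]; exact hσ w (hfv w hw hx))
      (fun w hw => by
        by_cases hx : w = x
        · subst hx; rw [Function.update_self]; exact hdfv
        · rw [Function.update_of_ne hx]; exact hσ' w (hfv w hw hx))
    have sub : ∀ {U : Set (Term B A X)}, insert d S ∪ σ '' (Term.mu x e).fv ⊆ U →
        S ∪ Function.update σ x d '' e.fv ⊆ U := by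
      rintro U hU c (hc | ⟨w, hw, rfl⟩)
      · exact hU (.inl (.inr hc))
      · by_cases hx : w = x
        · subst hx; rw [Function.update_self]; exact hU (.inl (.inl rfl))
        · rw [Function.update_of_ne hx]; exact hU (.inr ⟨w, hfv w hw hx, rfl⟩)
    have key : ∀ U, insert d S ∪ σ '' (Term.mu x e).fv ⊆ U → ∀ F, DerivIn G U F d := by
      intro U hU F
      have hdU : d ∈ U := hU (.inl (.inl rfl))
      -- The body is guarded, so its derivatives are controlled before anything is known about those
      -- of `d`. By `subst_bind` this instantiated body is the unfolding of `d`.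
      have := h.derivIn U (sub hU) F (.inl he.1)
      rw [← safe.subst_bind e x hdfv] at this
      rw [hmu] at hdU this ⊢
      exact .mu hG hdU fun _ => this
    refine ⟨insert d S, h.finite.insert _, .inl (.inl rfl), fun U hU F _ => key U hU F, ?_⟩
    rintro U hU hσU s (rfl | hs) F
    · exact key U hU F
    -- The substitution now sends `x` to `d`, and `key` supplies the required control of the
    -- derivatives of `d`.
    · refine h.closed U (sub hU) (fun w hw F => ?_) s hs F
      by_cases hx : w = x
      · subst hx; rw [Function.update_self]; exact key U hU F
      · rw [Function.update_of_ne hx]; exact hσU w (hfv w hw hx) F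
  | fst e ih =>
    intro σ safe hσ hσ'
    obtain ⟨S, h⟩ := ih he σ safe hσ hσ'
    exact ⟨_, h.guarded .fst rfl rfl fun U F => .fst hG⟩
  | snd e ih =>
    intro σ safe hσ hσ'
    obtain ⟨S, h⟩ := ih he σ safe hσ hσ'
    exact ⟨_, h.guarded .snd rfl rfl fun U F => .snd hG⟩
  | inl e ih =>
    intro σ safe hσ hσ'
    obtain ⟨S, h⟩ := ih he σ safe hσ hσ'
    exact ⟨_, h.guarded .inl rfl rfl fun U F => .inl hG⟩
  | inr e ih =>
    intro σ safe hσ hσ'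
    obtain ⟨S, h⟩ := ih he σ safe hσ hσ'
    exact ⟨_, h.guarded .inr rfl rfl fun U F => .inr hG⟩
  | act k a e ih =>
    intro σ safe hσ hσ'
    obtain ⟨S, h⟩ := ih he σ safe hσ hσ'
    exact ⟨_, h.guarded (.act k a) rfl rfl fun U F => .act hG⟩
  | single e ih =>
    intro σ safe hσ hσ'
    obtain ⟨S, h⟩ := ih he σ safe hσ hσ'
    exact ⟨_, h.guarded .single rfl rfl fun U F => .single hG⟩

theorem SumTree.derivIn {G : NDF B A} (hG : G ≠ .id) {S : Set (Term B A X)}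
    (hS : ∀ s ∈ S, ∀ F, DerivIn G S F s) {e : Term B A X} (he : SumTree S e) :
    DerivIn G S G e := by
  induction he with
  | emp => exact .emp hG G
  | of h => exact hS _ h G
  | plus _ _ ih₁ ih₂ =>
    intro h
    rw [delta_plus hG]
    exact SumTree.all_plus G (ih₁ _) (ih₂ _)

/-- Every `G`-expression lies in a set of sums of finitely many terms that is closed under
derivatives. -/
theorem Exp.exists_finite_span {G : NDF B A} (hG : G ≠ .id) (e : Exp X G G) :
    ∃ S : Set (Term B A X), S.Finite ∧ e.1 ∈ S ∧
      ∀ d : Exp X G G, SumTree S d.1 → G.All (fun c => SumTree S c.1) (deltaG G d) := by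
  have hfv : ∀ w, w ∉ e.1.fv := by simp [e.2.1]
  obtain ⟨S, h⟩ := exists_isClosure hG e.2.2.1 .var .var
    (fun w hw => (hfv w hw).elim) (fun w hw => (hfv w hw).elim)
  have hmem := h.mem
  have hclosed := h.closed S
  simp only [e.2.1, Finset.coe_empty, Set.image_empty, Set.union_empty, Term.bind_var] at *
  exact ⟨S, h.finite, hmem, fun d hd =>
    hd.derivIn hG (hclosed subset_rfl fun w hw => (hfv w hw).elim) _⟩

end Closure

/-! ### From a bisimulation to a finite system -/

section Completeness

variable {ι κ : Type u} {B : ι → Type u} {A : κ → Type u} {X : Type u}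
  [DecidableEq X] [Infinite X] [∀ i, SemilatticeSup (B i)] [∀ i, OrderBot (B i)]

/-- The elements of `S` below an expression. -/
def lowerPart (G : NDF B A) (S : Set (Term B A X)) (e : Term B A X) : Set S :=
  {s | ProvLe G G s.1 e}

/-- A sum of elements of `S` is the join of its summands, all of which belong to its lower part. -/
theorem SumTree.le_of_lowerPart_subset {G : NDF B A} {S : Set (Term B A X)} {e d : Term B A X}
    (he : SumTree S e) (hd : IsExp G G d) (h : IsExp G G e)
    (hed : lowerPart G S e ⊆ lowerPart G S d) : ProvLe G G e d := by
  -- The induction runs over subsums `c` of the fixed `e`, so that each summand is still compared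
  -- with `e` itself.
  have aux : ∀ {c : Term B A X}, SumTree S c → ProvLe G G c e → ProvLe G G c d := by
    intro c hc
    induction hc with
    | emp => exact fun _ => .emp hd
    | @of s hs => exact fun hle => hed (show (⟨s, hs⟩ : S) ∈ lowerPart G S e from hle)
    | plus _ _ ih₁ ih₂ =>
      intro hle
      have hc := hle.isExp.1
      exact .plus (ih₁ ((ProvLe.plus_left hc.of_plus_left hc.of_plus_right).trans hle))
        (ih₂ ((ProvLe.plus_right hc.of_plus_left hc.of_plus_right).trans hle))
  exact aux he (ProvEq.refl h).le

theorem SumTree.provEq_of_lowerPart_eq {G : NDF B A} {S : Set (Term B A X)} {e d : Term B A X}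
    (he : SumTree S e) (hd : SumTree S d) (he' : IsExp G G e) (hd' : IsExp G G d)
    (hed : lowerPart G S e = lowerPart G S d) : ProvEq G G e d :=
  (he.le_of_lowerPart_subset hd' he' hed.subset).antisymm
    (hd.le_of_lowerPart_subset he' hd' hed.superset)

variable [∀ k, Finite (A k)]

theorem ProvEq.of_bisimilar {G : NDF B A} (hG : G ≠ .id) {E₁ E₂ : Exp X G G}
    (h : Bisimilar G (deltaG G) (deltaG G) E₁ E₂) : ProvEq G G E₁.1 E₂.1 := by
  have hGG : G.Ingredient G := Relation.ReflTransGen.refl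
  obtain ⟨R, hR, hE⟩ := h
  obtain ⟨S₁, fin₁, mem₁, closed₁⟩ := E₁.exists_finite_span hG
  obtain ⟨S₂, fin₂, mem₂, closed₂⟩ := E₂.exists_finite_span hG
  have := fin₁.to_subtype
  have := fin₂.to_subtype
  -- The pairs in the two spans: they include `(E₁, E₂)`, and by `step` the bisimulation restricts
  -- to them. The code of such a pair ranges over a finite set because `S₁` and `S₂` are finite.
  let T : R → Prop := fun r => SumTree S₁ r.1.1.1 ∧ SumTree S₂ r.1.2.1
  let code : {r : R // T r} → Set S₁ × Set S₂ := fun r =>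
    (lowerPart G S₁ r.1.1.1.1, lowerPart G S₂ r.1.1.2.1)
  have code₁ : ∀ {r r'}, code r = code r' → ProvEq G G r.1.1.1.1 r'.1.1.1.1 := fun {r r'} h =>
    r.2.1.provEq_of_lowerPart_eq r'.2.1 r.1.1.1.2 r'.1.1.1.2 (congrArg Prod.fst h)
  have code₂ : ∀ {r r'}, code r = code r' → ProvEq G G r.1.1.2.1 r'.1.1.2.1 := fun {r r'} h =>
    r.2.2.provEq_of_lowerPart_eq r'.2.2 r.1.1.2.2 r'.1.1.2.2 (congrArg Prod.snd h)
  have step : ∀ r : {r : R // T r}, ∃ d : G.obj {r : R // T r},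
      G.map (fun r => r.1.1.1) d = deltaG G r.1.1.1 ∧
      G.map (fun r => r.1.1.2) d = deltaG G r.1.1.2 := by
    rintro ⟨r, hr₁, hr₂⟩
    obtain ⟨c, hc₁, hc₂⟩ := hR _ _ r.2
    have h₁ := closed₁ _ hr₁
    have h₂ := closed₂ _ hr₂
    rw [← hc₁] at h₁
    rw [← hc₂] at h₂
    -- Both projections of the witness `c` have all entries in the spans, so every entry of `c`
    -- satisfies `T`.
    obtain ⟨d, rfl⟩ := (h₁.of_map.and G h₂.of_map).exists_map_val
    rw [NDF.map_map] at hc₁ hc₂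
    exact ⟨d, hc₁, hc₂⟩
  choose d hd₁ hd₂ using step
  let cls : {r : R // T r} → Set.range code := fun r => ⟨code r, r, rfl⟩
  choose rep hrep using fun p : Set.range code => p.2
  have hcls : ∀ r, code (rep (cls r)) = code r := fun r => hrep (cls r)
  -- The unknowns are the codes; the derivative of a representative pair is read modulo codes. Both
  -- coordinates of the representatives solve this system, because passing from a pair to the
  -- representative of its class changes each coordinate only up to `≡`.
  let u : Set.range code → G.obj (Set.range code) := fun p => G.map cls (d (rep p))
  let v₁ : {r : R // T r} → Term B A X := fun r => r.1.1.1.1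
  let v₂ : {r : R // T r} → Term B A X := fun r => r.1.1.2.1
  have key := ProvEq.of_system hG u (s := fun p => (rep p).1.1.1.1)
    (t := fun p => (rep p).1.1.2.1)
    (fun p => by
      refine (ProvEq.toTerm_delta hG G _ (rep p).1.1.1.2).trans ?_
      change ProvEq G G (G.toTerm _ (deltaG G (rep p).1.1.1)) _
      rw [← hd₁]
      exact (ProvEq.toTerm_map (f := fun r : {r : R // T r} => r.1.1.1) (v := Subtype.val)
        (w := v₁) (fun r => .refl r.1.1.1.2) G hGG _).trans
        (ProvEq.toTerm_map (v := fun p => v₁ (rep p)) (fun r => code₁ (hcls r)) G hGG _).symm)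
    (fun p => by
      refine (ProvEq.toTerm_delta hG G _ (rep p).1.1.2.2).trans ?_
      change ProvEq G G (G.toTerm _ (deltaG G (rep p).1.1.2)) _
      rw [← hd₂]
      exact (ProvEq.toTerm_map (f := fun r : {r : R // T r} => r.1.1.2) (v := Subtype.val)
        (w := v₂) (fun r => .refl r.1.1.2.2) G hGG _).trans
        (ProvEq.toTerm_map (v := fun p => v₂ (rep p)) (fun r => code₂ (hcls r)) G hGG _).symm)
  let r₀ : {r : R // T r} := ⟨⟨(E₁, E₂), hE⟩, .of mem₁, .of mem₂⟩
  exact (code₁ (hcls r₀)).symm.trans ((key (cls r₀)).trans (code₂ (hcls r₀)))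

end Completeness

end NDCoalg

theorem mainTheorem3 {ι κ X : Type u} [DecidableEq X] [Infinite X]
    {B : ι → Type u} [∀ i, SemilatticeSup (B i)] [∀ i, OrderBot (B i)] [∀ i, Finite (B i)]
    {A : κ → Type u} [∀ k, Finite (A k)]
    (G : NDCoalg.NDF B A) (E₁ E₂ : NDCoalg.Exp X G G)
    (h : NDCoalg.Bisimilar G (NDCoalg.deltaG G) (NDCoalg.deltaG G) E₁ E₂) :
    NDCoalg.ProvEq G G E₁.1 E₂.1 := by
  by_cases hG : G = .id
  · subst hG
    exact (NDCoalg.ProvEq.eq_emp E₁.2).trans (NDCoalg.ProvEq.eq_emp E₂.2).symm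
  · exact NDCoalg.ProvEq.of_bisimilar hG h
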